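/- **Theorem 4.3.** Let $p,q$ be positive integers and let $(M,\phi,Z_1,Z_2,\alpha_1,\alpha_2,g)$ be a normal metric contact pair manifold of type $(p,q)$ with decomposable $\phi$. That is: * $M$ is a smooth manifold of dimension $n=2p+2q+2$ and $(\alpha_1,\alpha_2)$ is a pair of smooth $1$-forms with $\alpha_1\wedge(d\alpha_1)^p\wedge\alpha_2\wedge(d\alpha_2)^q\neq 0$ everywhere, $(d\alpha_1)^{p+1}=0$ and $(d\alpha_2)^{q+1}=0$; * $Z_1,Z_2$ are the Reeb vector fields: $\alpha_i(Z_j)=\delta_{ij}$ and $i_{Z_j}d\alpha_i=0$ for $i,j\in\{1,2\}$; * $\phi$ is a smooth $(1,1)$-tensor field with $\phi^2=-I+\alpha_1\otimes Z_1+\alpha_2\otimes Z_2$ and $\phi Z_1=\phi Z_2=0$, and $\phi$ preserves $\ker\alpha_i\cap\ker d\alpha_i$ for $i=1,2$; * $g$ is a Riemannian metric with $g(X,\phi Y)=(d\alpha_1+d\alpha_2)(X,Y)$ and $g(X,Z_i)=\alpha_i(X)$, where $d\alpha(X,Y)=\tfrac12\big(X\alpha(Y)-Y\alpha(X)-\alpha([X,Y])\big)$;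 * the almost complex structures $J=\phi-\alpha_2\otimes Z_1+\alpha_1\otimes Z_2$ and $T=\phi+\alpha_2\otimes Z_1-\alpha_1\otimes Z_2$ are integrable, i.e. their Nijenhuis tensors vanish. Let $R(X,Y)W=\nabla_X\nabla_YW-\nabla_Y\nabla_XW-\nabla_{[X,Y]}W$ be the curvature of the Levi-Civita connection, $QX=\sum_i R(X,E_i)E_i$ for an orthonormal frame $(E_i)$, $\mathrm{Ric}(X,Y)=g(QX,Y)$ and $\mathrm{scal}=\sum_i\mathrm{Ric}(E_i,E_i)$. Let $a,b\in\mathbb R$ satisfy $a+b(2p+2q)\neq 0$, and suppose that the quasi-conformal curvature tensor $$\begin{aligned}\widetilde{\mathcal C}(X_1,X_2)X_3={}&aR(X_1,X_2)X_3+b\big[\mathrm{Ric}(X_2,X_3)X_1-\mathrm{Ric}(X_1,X_3)X_2+g(X_2,X_3)QX_1-g(X_1,X_3)QX_2\big]\\&-\frac{\mathrm{scal}}{2p+2q+2}\Big[\frac{a}{2p+2q+1}+2b\Big]\big[g(X_2,X_3)X_1-g(X_1,X_3)X_2\big]\end{aligned}$$ vanishes identically on $M$. Then: 1. $M$ is an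 Einstein manifold with $\mathrm{Ric}=(p+q)\,g$, and its scalar curvature is positive: $\mathrm{scal}=2(p+q)(p+q+1)>0$. 2. If moreover $a\neq 0$, then $M$ has constant sectional curvature $\dfrac{p+q}{2p+2q+1}$. -/

import Mathlib

open Bundle
open scoped Manifold ContDiff

set_option linter.unusedSectionVars false
set_option linter.unusedVariables false

namespace ContactPairGeometry
section
variable {E : Type*} [NormedAddCommGroup E] [NormedSpace ℝ E] [FiniteDimensional ℝ E]
  {H : Type*} [TopologicalSpace H] {I : ModelWithCorners ℝ E H}
  {M : Type*} [TopologicalSpace M] [ChartedSpace H M] [IsManifold I ∞ M]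

/-! ### Differential forms -/

variable (I M) in
/-- A smooth `1`-form on `M`: a smooth section of the cotangent bundle. -/
structure SmoothOneForm where
  /-- The covector at each point. -/
  toFun : ∀ x : M, TangentSpace I x →L[ℝ] ℝ
  contMDiff : ContMDiff I (I.prod 𝓘(ℝ, E →L[ℝ] ℝ)) ∞
    (fun x ↦ TotalSpace.mk' (E →L[ℝ] ℝ)
      (E := fun x : M ↦ TangentSpace I x →L[ℝ] Bundle.Trivial M ℝ x) x (toFun x))

/-- The formula `½ (X (α Y) - Y (α X) - α [X, Y])` at the point `x`, for vector fields `X`, `Y`. -/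
noncomputable def extDerivAux (α : ∀ x : M, TangentSpace I x →L[ℝ] ℝ)
    (X Y : ∀ x : M, TangentSpace I x) (x : M) : ℝ :=
  (1 / 2) * (mvfderiv I (fun y ↦ α y (Y y)) x (X x) - mvfderiv I (fun y ↦ α y (X y)) x (Y x)
    - α x (VectorField.mlieBracket I X Y x))

theorem SmoothOneForm.mdifferentiableAt_apply (α : SmoothOneForm I M)
    {X : ∀ x : M, TangentSpace I x} {x : M} (hX : MDiffAt (T% X) x) :
    MDiffAt (fun y ↦ α.toFun y (X y)) x := by
  have h := (α.contMDiff.mdifferentiable (by simp) x)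
  have : MDifferentiableAt I (I.prod 𝓘(ℝ, ℝ)) 
     (fun m ↦ TotalSpace.mk' ℝ (E := Bundle.Trivial M ℝ) m (α.toFun m (X m))) x := by
    apply MDifferentiableAt.clm_bundle_apply (F₁ := E) h hX
  simp only [mdifferentiableAt_totalSpace] at this
  exact this.2

theorem extDerivAux_tensorial₁ (α : SmoothOneForm I M) (x : M)
    (Y : ∀ x : M, TangentSpace I x) (hY : MDiffAt (T% Y) x) :
    TensorialAt I E (fun X ↦ extDerivAux α.toFun X Y x) x where
  smul {f X} hf hX := by
    have h1 := mvfderiv_fun_mul hf (α.mdifferentiableAt_apply hX)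
    simp [extDerivAux, VectorField.mlieBracket_smul_left hf hX, h1]
    ring
  add {X X'} hX hX' := by
    have h1 := mvfderiv_fun_add (α.mdifferentiableAt_apply hX) (α.mdifferentiableAt_apply hX')
    simp [extDerivAux, VectorField.mlieBracket_add_left hX hX', h1]
    ring

theorem extDerivAux_swap (α : SmoothOneForm I M) (x : M)
    (X Y : ∀ x : M, TangentSpace I x) :
    extDerivAux α.toFun X Y x = - extDerivAux α.toFun Y X x := by
  rw [extDerivAux, extDerivAux, VectorField.mlieBracket_swap_apply]
  simp
  ring

theorem extDerivAux_tensorial₂ (α : SmoothOneForm I M) (x : M)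
    (X : ∀ x : M, TangentSpace I x) (hX : MDiffAt (T% X) x) :
    TensorialAt I E (fun Y ↦ extDerivAux α.toFun X Y x) x where
  smul {f Y} hf hY := by
    have h := (extDerivAux_tensorial₁ α x X hX).smul hf hY
    rw [extDerivAux_swap, h, extDerivAux_swap α x X Y]
    simp
  add {Y Y'} hY hY' := by
    have h := (extDerivAux_tensorial₁ α x X hX).add hY hY'
    rw [extDerivAux_swap, h, extDerivAux_swap α x X Y, extDerivAux_swap α x X Y']
    ring

/-- The exterior derivative of a smooth `1`-form `α`, as a bilinear form on each tangent space,
with the normalization `dα(X, Y) = ½ (X (α Y) - Y (α X) - α [X, Y])` that is customary in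
contact metric geometry. -/
noncomputable def SmoothOneForm.d (α : SmoothOneForm I M) (x : M) :
    TangentSpace I x →L[ℝ] TangentSpace I x →L[ℝ] ℝ :=
  TensorialAt.mkHom₂ (fun X Y ↦ extDerivAux α.toFun X Y x) x
    (extDerivAux_tensorial₁ α x) (extDerivAux_tensorial₂ α x)

theorem SmoothOneForm.d_apply (α : SmoothOneForm I M) {x : M} {X Y : ∀ x : M, TangentSpace I x}
    (hX : MDiffAt (T% X) x) (hY : MDiffAt (T% Y) x) :
    α.d x (X x) (Y x) = (1 / 2) * (mvfderiv I (fun y ↦ α.toFun y (Y y)) x (X x)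
      - mvfderiv I (fun y ↦ α.toFun y (X y)) x (Y x)
      - α.toFun x (VectorField.mlieBracket I X Y x)) :=
  TensorialAt.mkHom₂_apply (extDerivAux_tensorial₁ α x) (extDerivAux_tensorial₂ α x) hX hY

theorem SmoothOneForm.d_swap (α : SmoothOneForm I M) (x : M) (u v : TangentSpace I x) :
    α.d x u v = - α.d x v u :=
  extDerivAux_swap α x _ _

/-- The value of a `1`-form at a point, as an alternating form of degree `1`. -/
noncomputable def SmoothOneForm.alt (α : SmoothOneForm I M) (x : M) :
    TangentSpace I x [⋀^Fin 1]→ₗ[ℝ] ℝ :=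
  AlternatingMap.ofSubsingleton ℝ (TangentSpace I x) ℝ (0 : Fin 1) (α.toFun x : _ →ₗ[ℝ] ℝ)

/-- The value of `dα` at a point, as an alternating form of degree `2`. -/
noncomputable def SmoothOneForm.dAlt (α : SmoothOneForm I M) (x : M) :
    TangentSpace I x [⋀^Fin 2]→ₗ[ℝ] ℝ where
  toFun v := α.d x (v 0) (v 1)
  map_update_add' v i u w := by
    fin_cases i <;> simp [Function.update]
  map_update_smul' v i c u := by
    fin_cases i <;> simp [Function.update]
  map_eq_zero_of_eq' v i j hv hij := by
    have h : v 0 = v 1 := by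
      fin_cases i <;> fin_cases j <;> simp_all
    rw [h]
    linarith [α.d_swap x (v 1) (v 1)]

end

section Wedge

variable {V : Type*} [AddCommGroup V] [Module ℝ V]

/-- The wedge product of two alternating forms on a real vector space. -/
noncomputable def wedge {m k : ℕ} (β : V [⋀^Fin m]→ₗ[ℝ] ℝ) (η : V [⋀^Fin k]→ₗ[ℝ] ℝ) :
    V [⋀^Fin (m + k)]→ₗ[ℝ] ℝ :=
  ((LinearMap.mul' ℝ ℝ).compAlternatingMap (β.domCoprod η)).domDomCongr finSumFinEquiv

/-- The `k`-th wedge power of a `2`-form. -/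
noncomputable def wedgePow (β : V [⋀^Fin 2]→ₗ[ℝ] ℝ) : (k : ℕ) → V [⋀^Fin (2 * k)]→ₗ[ℝ] ℝ
  | 0 => AlternatingMap.constOfIsEmpty ℝ V (Fin 0) 1
  | k + 1 => wedge (wedgePow β k) β

end Wedge

section

variable {E : Type*} [NormedAddCommGroup E] [NormedSpace ℝ E] [FiniteDimensional ℝ E]
  {H : Type*} [TopologicalSpace H] {I : ModelWithCorners ℝ E H}
  {M : Type*} [TopologicalSpace M] [ChartedSpace H M] [IsManifold I ∞ M]
  [RiemannianBundle (fun x : M ↦ TangentSpace I x)]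
  [IsContMDiffRiemannianBundle I ∞ E (fun x : M ↦ TangentSpace I x)]

/-! ### The Levi-Civita connection -/

/-- Half the right-hand side of the Koszul formula, that is, `g(∇_X Y, Z)` for the Levi-Civita
connection `∇`. -/
noncomputable def koszul (X Y Z : ∀ x : M, TangentSpace I x) (x : M) : ℝ :=
  (1 / 2) * (mvfderiv I (fun y ↦ inner ℝ (Y y) (Z y)) x (X x)
    + mvfderiv I (fun y ↦ inner ℝ (X y) (Z y)) x (Y x)
    - mvfderiv I (fun y ↦ inner ℝ (X y) (Y y)) x (Z x)
    + inner ℝ (VectorField.mlieBracket I X Y x) (Z x)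
    - inner ℝ (VectorField.mlieBracket I X Z x) (Y x)
    - inner ℝ (VectorField.mlieBracket I Y Z x) (X x))

theorem mdiff_inner {X Y : ∀ x : M, TangentSpace I x} {x : M}
    (hX : MDiffAt (T% X) x) (hY : MDiffAt (T% Y) x) :
    MDiffAt (fun y ↦ inner ℝ (X y) (Y y)) x := by
  exact MDifferentiableAt.inner_bundle (IB := I) (F := E) (E := fun y : M ↦ TangentSpace I y)
    (b := fun y ↦ y) (v := X) (w := Y) hX hY

theorem koszul_tensorial₁ {Y : ∀ x : M, TangentSpace I x} {x : M} (hY : MDiffAt (T% Y) x)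
    (Z : ∀ x : M, TangentSpace I x) (hZ : MDiffAt (T% Z) x) :
    TensorialAt I E (fun X ↦ koszul X Y Z x) x where
  smul {f X} hf hX := by
    have h1 := mvfderiv_fun_mul hf (mdiff_inner hX hY)
    have h2 := mvfderiv_fun_mul hf (mdiff_inner hX hZ)
    simp [koszul, VectorField.mlieBracket_smul_left hf hX, h1, h2, inner_add_left, 
     inner_smul_left, inner_smul_right]
    ring
  add {X X'} hX hX' := by
    have h1 := mvfderiv_fun_add (mdiff_inner hX hY) (mdiff_inner hX' hY)
    have h2 := mvfderiv_fun_add (mdiff_inner hX hZ) (mdiff_inner hX' hZ)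
    simp [koszul, VectorField.mlieBracket_add_left hX hX', h1, h2, inner_add_left, inner_add_right]
    ring

theorem koszul_tensorial₂ {Y : ∀ x : M, TangentSpace I x} {x : M} (hY : MDiffAt (T% Y) x)
    (X : ∀ x : M, TangentSpace I x) (hX : MDiffAt (T% X) x) :
    TensorialAt I E (fun Z ↦ koszul X Y Z x) x where
  smul {f Z} hf hZ := by
    have h1 := mvfderiv_fun_mul hf (mdiff_inner hY hZ)
    have h2 := mvfderiv_fun_mul hf (mdiff_inner hX hZ)
    simp [koszul, VectorField.mlieBracket_smul_right hf hZ, h1, h2, inner_add_left,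
      inner_smul_left, inner_smul_right]
    rw [real_inner_comm (Y x) (Z x), real_inner_comm (X x) (Z x)]
    ring
  add {Z Z'} hZ hZ' := by
    have h1 := mvfderiv_fun_add (mdiff_inner hY hZ) (mdiff_inner hY hZ')
    have h2 := mvfderiv_fun_add (mdiff_inner hX hZ) (mdiff_inner hX hZ')
    simp [koszul, VectorField.mlieBracket_add_right hZ hZ', h1, h2, inner_add_left, inner_add_right]
    ring

theorem finiteDimensional_tangentSpace (x : M) : FiniteDimensional ℝ (TangentSpace I x) :=
  inferInstanceAs (FiniteDimensional ℝ E)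

open Classical in
/-- `leviCivitaFun Y x v` is `∇_v Y` at the point `x`: the tangent vector that represents the
covector given by the Koszul formula (and `0` by convention where `Y` is not differentiable). -/
noncomputable def leviCivitaFun (Y : ∀ x : M, TangentSpace I x) (x : M) :
    TangentSpace I x →L[ℝ] TangentSpace I x :=
  if hY : MDiffAt (T% Y) x then
    have := finiteDimensional_tangentSpace (I := I) x
    have := FiniteDimensional.complete ℝ (TangentSpace I x)
    LinearMap.toContinuousLinearMap
      { toFun v := (InnerProductSpace.toDual ℝ (TangentSpace I x)).symm
          (TensorialAt.mkHom₂ (fun X Z ↦ koszul X Y Z x) x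
            (koszul_tensorial₁ hY) (koszul_tensorial₂ hY) v)
        map_add' v w := by simp
        map_smul' c v := by simp }
  else 0

theorem inner_leviCivitaFun {X Y Z : ∀ x : M, TangentSpace I x} {x : M}
    (hX : MDiffAt (T% X) x) (hY : MDiffAt (T% Y) x) (hZ : MDiffAt (T% Z) x) :
    inner ℝ (leviCivitaFun Y x (X x)) (Z x) = koszul X Y Z x := by
  have := finiteDimensional_tangentSpace (I := I) x
  have := FiniteDimensional.complete ℝ (TangentSpace I x)
  rw [leviCivitaFun, dif_pos hY]
  simp
  exact TensorialAt.mkHom₂_apply (koszul_tensorial₁ hY) (koszul_tensorial₂ hY) hX hZ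

theorem ext_inner_fields {x : M} {A B : TangentSpace I x →L[ℝ] TangentSpace I x}
    (h : ∀ X Z : ∀ x : M, TangentSpace I x, MDiffAt (T% X) x → MDiffAt (T% Z) x →
      inner ℝ (A (X x)) (Z x) = inner ℝ (B (X x)) (Z x)) : A = B := by
  ext1 v
  refine ext_inner_right ℝ fun w ↦ ?_
  have := h (FiberBundle.extend E v) (FiberBundle.extend E w)
    (FiberBundle.mdifferentiableAt_extend ..) (FiberBundle.mdifferentiableAt_extend ..)
  simpa using this

variable (I M) in
/-- The Levi-Civita connection of the Riemannian manifold `M`; `leviCivita I M Y x (X x)` is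
`∇_X Y` at `x`. -/
noncomputable def leviCivita : CovariantDerivative I E (fun x : M ↦ TangentSpace I x) where
  toFun := leviCivitaFun
  isCovariantDerivativeOnUniv :=
    { add := by
        intro Y Y' x hY hY' _
        refine ext_inner_fields fun X Z hX hZ ↦ ?_
        have h1 := mvfderiv_fun_add (mdiff_inner hY hZ) (mdiff_inner hY' hZ)
        have h2 := mvfderiv_fun_add (mdiff_inner hX hY) (mdiff_inner hX hY')
        have h3 : MDiffAt (T% (Y + Y')) x := mdifferentiableAt_add_section hY hY'
        simp only [add_apply, inner_add_left]
        rw [inner_leviCivitaFun hX h3 hZ, inner_leviCivitaFun hX hY hZ,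
          inner_leviCivitaFun hX hY' hZ]
        simp [koszul, VectorField.mlieBracket_add_right hY hY',
          VectorField.mlieBracket_add_left hY hY', h1, h2, inner_add_left, inner_add_right]
        ring
      leibniz := by
        intro Y f x hY hf _
        refine ext_inner_fields fun X Z hX hZ ↦ ?_
        have h1 := mvfderiv_fun_mul hf (mdiff_inner hY hZ)
        have h2 := mvfderiv_fun_mul hf (mdiff_inner hX hY)
        have h3 : MDiffAt (T% (f • Y)) x := hf.smul_section hY
        rw [inner_leviCivitaFun hX h3 hZ]
        simp only [add_apply, inner_add_left, smul_apply,
          inner_smul_left, ContinuousLinearMap.smulRight_apply, inner_leviCivitaFun hX hY hZ]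
        simp [koszul, VectorField.mlieBracket_smul_right hf hY,
          VectorField.mlieBracket_smul_left hf hY, h1, h2, inner_add_left, inner_smul_left,
          inner_smul_right]
        rw [real_inner_comm (X x) (Y x)]
        ring }

/-- The Levi-Civita connection is compatible with the metric. -/
theorem leviCivita_metric {X Y Z : ∀ x : M, TangentSpace I x} {x : M}
    (hX : MDiffAt (T% X) x) (hY : MDiffAt (T% Y) x) (hZ : MDiffAt (T% Z) x) :
    mvfderiv I (fun y ↦ inner ℝ (Y y) (Z y)) x (X x) =
      inner ℝ (leviCivita I M Y x (X x)) (Z x) + inner ℝ (Y x) (leviCivita I M Z x (X x)) := by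
  have h1 : inner ℝ (leviCivita I M Y x (X x)) (Z x) = koszul X Y Z x :=
    inner_leviCivitaFun hX hY hZ
  have h2 : inner ℝ (Y x) (leviCivita I M Z x (X x)) = koszul X Z Y x := by
    rw [real_inner_comm]
    exact inner_leviCivitaFun hX hZ hY
  rw [h1, h2, koszul, koszul, VectorField.mlieBracket_swap_apply (V := Y) (W := Z)]
  simp only [inner_neg_left, real_inner_comm]
  simp_rw [fun y ↦ real_inner_comm (Z y) (Y y)]
  ring

/-- The Levi-Civita connection is torsion-free. -/
theorem leviCivita_torsion {X Y : ∀ x : M, TangentSpace I x} {x : M}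
    (hX : MDiffAt (T% X) x) (hY : MDiffAt (T% Y) x) :
    leviCivita I M Y x (X x) - leviCivita I M X x (Y x) = VectorField.mlieBracket I X Y x := by
  refine ext_inner_right ℝ fun w ↦ ?_
  have hw : MDiffAt (T% (FiberBundle.extend E w)) x := FiberBundle.mdifferentiableAt_extend ..
  have h1 := inner_leviCivitaFun hX hY hw
  have h2 := inner_leviCivitaFun hY hX hw
  rw [FiberBundle.extend_apply_self] at h1 h2
  rw [inner_sub_left]
  refine (congrArg₂ (· - ·) h1 h2).trans ?_
  rw [koszul, koszul, VectorField.mlieBracket_swap_apply (V := Y) (W := X)]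
  simp only [inner_neg_left, FiberBundle.extend_apply_self]
  simp_rw [fun y ↦ real_inner_comm (X y) (Y y)]
  ring

/-! ### Curvature -/

/-- The Riemann curvature tensor `R(u, v) w` at `x`, that is,
`∇_U ∇_V W - ∇_V ∇_U W - ∇_[U, V] W` for vector fields `U`, `V`, `W` extending `u`, `v`, `w`
(smoothly near `x`). -/
noncomputable def curvature (x : M) (u v w : TangentSpace I x) : TangentSpace I x :=
  let U : ∀ y : M, TangentSpace I y := FiberBundle.extend E u
  let V : ∀ y : M, TangentSpace I y := FiberBundle.extend E v
  let W : ∀ y : M, TangentSpace I y := FiberBundle.extend E w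
  leviCivita I M (fun y ↦ leviCivita I M W y (V y)) x u
    - leviCivita I M (fun y ↦ leviCivita I M W y (U y)) x v
    - leviCivita I M W x (VectorField.mlieBracket I U V x)

/-- The Ricci operator `Q u = ∑ i, R(u, e i) (e i)`, where `e` is an orthonormal basis. -/
noncomputable def ricciOp (x : M) (u : TangentSpace I x) : TangentSpace I x :=
  haveI := finiteDimensional_tangentSpace (I := I) x
  ∑ i, curvature x u (stdOrthonormalBasis ℝ (TangentSpace I x) i)
    (stdOrthonormalBasis ℝ (TangentSpace I x) i)

/-- The Ricci curvature `Ric(u, v) = g(Q u, v)`. -/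
noncomputable def ricci (x : M) (u v : TangentSpace I x) : ℝ :=
  inner ℝ (ricciOp x u) v

variable (I) in
/-- The scalar curvature `∑ i, Ric(e i, e i)`, where `e` is an orthonormal basis. -/
noncomputable def scalarCurvature (x : M) : ℝ :=
  haveI := finiteDimensional_tangentSpace (I := I) x
  ∑ i, ricci x (stdOrthonormalBasis ℝ (TangentSpace I x) i)
    (stdOrthonormalBasis ℝ (TangentSpace I x) i)

/-- The sectional curvature of the plane spanned by `u` and `v` (for linearly independent
`u`, `v`). -/
noncomputable def sectionalCurvature (x : M) (u v : TangentSpace I x) : ℝ :=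
  inner ℝ (curvature x u v v) u / (inner ℝ u u * inner ℝ v v - inner ℝ u v ^ 2)

variable (I M) in
/-- `M` has constant sectional curvature `c`. -/
def HasConstantSectionalCurvature (c : ℝ) : Prop :=
  ∀ (x : M) (u v : TangentSpace I x), LinearIndependent ℝ ![u, v] → sectionalCurvature x u v = c

variable (I M) in
/-- `M` is an Einstein manifold with Einstein constant `c`, that is, `Ric = c g`. -/
def IsEinsteinWith (c : ℝ) : Prop :=
  ∀ (x : M) (u v : TangentSpace I x), ricci x u v = c * inner ℝ u v

/-- The quasi-conformal curvature tensor with constants `a`, `b` of a Riemannian manifold of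
dimension `n = finrank ℝ E`. -/
noncomputable def quasiConformalCurvature (a b : ℝ) (x : M) (u v w : TangentSpace I x) :
    TangentSpace I x :=
  a • curvature x u v w
    + b • (ricci x v w • u - ricci x u w • v
      + (inner ℝ v w : ℝ) • ricciOp x u - (inner ℝ u w : ℝ) • ricciOp x v)
    - (scalarCurvature I x / (Module.finrank ℝ E : ℝ)
        * (a / ((Module.finrank ℝ E : ℝ) - 1) + 2 * b)) •
      ((inner ℝ v w : ℝ) • u - (inner ℝ u w : ℝ) • v)

variable (I M) in
/-- The quasi-conformal curvature tensor with constants `a`, `b` vanishes identically. -/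
def IsQuasiConformallyFlat (a b : ℝ) : Prop :=
  ∀ (x : M) (u v w : TangentSpace I x), quasiConformalCurvature a b x u v w = 0

end

section

variable {E : Type*} [NormedAddCommGroup E] [NormedSpace ℝ E] [FiniteDimensional ℝ E]
  {H : Type*} [TopologicalSpace H] {I : ModelWithCorners ℝ E H}
  {M : Type*} [TopologicalSpace M] [ChartedSpace H M] [IsManifold I ∞ M]

/-! ### Contact pairs -/

variable (I M) in
/-- A contact pair `(α₁, α₂)` of type `(p, q)` on a manifold `M` (of dimension `2p + 2q + 2`). -/
structure ContactPair (p q : ℕ) where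
  /-- The first form of the pair. -/
  α₁ : SmoothOneForm I M
  /-- The second form of the pair. -/
  α₂ : SmoothOneForm I M
  volume_ne_zero : ∀ x : M,
    wedge (wedge (wedge (α₁.alt x) (wedgePow (α₁.dAlt x) p)) (α₂.alt x))
      (wedgePow (α₂.dAlt x) q) ≠ 0
  pow₁ : ∀ x : M, wedgePow (α₁.dAlt x) (p + 1) = 0
  pow₂ : ∀ x : M, wedgePow (α₂.dAlt x) (q + 1) = 0

variable (I M) in
/-- An almost contact pair structure `(α₁, α₂, φ)`: a contact pair with its (uniquely determined)
Reeb vector fields `Z₁`, `Z₂`, and a smooth `(1, 1)`-tensor field `φ` such that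
`φ² = -1 + α₁ ⊗ Z₁ + α₂ ⊗ Z₂` and `φ Z₁ = φ Z₂ = 0`. (It follows that `α₁ ∘ φ = α₂ ∘ φ = 0` and
that `φ` has rank `dim M - 2`.) -/
structure AlmostContactPairStructure (p q : ℕ) extends ContactPair I M p q where
  /-- The first Reeb vector field. -/
  Z₁ : ∀ x : M, TangentSpace I x
  /-- The second Reeb vector field. -/
  Z₂ : ∀ x : M, TangentSpace I x
  smooth_Z₁ : CMDiff ∞ (T% Z₁)
  smooth_Z₂ : CMDiff ∞ (T% Z₂)
  α₁_Z₁ : ∀ x, α₁.toFun x (Z₁ x) = 1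
  α₁_Z₂ : ∀ x, α₁.toFun x (Z₂ x) = 0
  α₂_Z₁ : ∀ x, α₂.toFun x (Z₁ x) = 0
  α₂_Z₂ : ∀ x, α₂.toFun x (Z₂ x) = 1
  d_α₁_Z₁ : ∀ x v, α₁.d x (Z₁ x) v = 0
  d_α₁_Z₂ : ∀ x v, α₁.d x (Z₂ x) v = 0
  d_α₂_Z₁ : ∀ x v, α₂.d x (Z₁ x) v = 0
  d_α₂_Z₂ : ∀ x v, α₂.d x (Z₂ x) v = 0
  /-- The structure endomorphism. -/
  φ : ∀ x : M, TangentSpace I x →L[ℝ] TangentSpace I x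
  smooth_φ : ContMDiff I (I.prod 𝓘(ℝ, E →L[ℝ] E)) ∞
    (fun x ↦ TotalSpace.mk' (E →L[ℝ] E) (E := fun x : M ↦ TangentSpace I x →L[ℝ] TangentSpace I x)
      x (φ x))
  φ_sq : ∀ x v, φ x (φ x v) = -v + α₁.toFun x v • Z₁ x + α₂.toFun x v • Z₂ x
  φ_Z₁ : ∀ x, φ x (Z₁ x) = 0
  φ_Z₂ : ∀ x, φ x (Z₂ x) = 0

/-- The Nijenhuis tensor of an endomorphism field `A` of the tangent bundle with `A² = -1`, on
vector fields `X`, `Y`: `[AX, AY] - A [AX, Y] - A [X, AY] - [X, Y]`. -/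
noncomputable def nijenhuis (A : ∀ x : M, TangentSpace I x →L[ℝ] TangentSpace I x)
    (X Y : ∀ x : M, TangentSpace I x) (x : M) : TangentSpace I x :=
  VectorField.mlieBracket I (fun y ↦ A y (X y)) (fun y ↦ A y (Y y)) x
    - A x (VectorField.mlieBracket I (fun y ↦ A y (X y)) Y x)
    - A x (VectorField.mlieBracket I X (fun y ↦ A y (Y y)) x)
    - VectorField.mlieBracket I X Y x

/-- An almost complex structure is integrable if its Nijenhuis tensor vanishes. -/
def IsIntegrable (A : ∀ x : M, TangentSpace I x →L[ℝ] TangentSpace I x) : Prop :=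
  ∀ (X Y : ∀ x : M, TangentSpace I x) (x : M), MDiffAt (T% X) x → MDiffAt (T% Y) x →
    nijenhuis A X Y x = 0

namespace AlmostContactPairStructure

variable {p q : ℕ} (S : AlmostContactPairStructure I M p q)

/-- The endomorphism `φ` is decomposable: it preserves the tangent bundles `ker αᵢ ∩ ker dαᵢ` of
the two characteristic foliations. -/
def IsDecomposable : Prop :=
  (∀ x v, S.α₁.toFun x v = 0 → S.α₁.d x v = 0 →
    S.α₁.toFun x (S.φ x v) = 0 ∧ S.α₁.d x (S.φ x v) = 0) ∧
  (∀ x v, S.α₂.toFun x v = 0 → S.α₂.d x v = 0 →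
    S.α₂.toFun x (S.φ x v) = 0 ∧ S.α₂.d x (S.φ x v) = 0)

/-- The almost complex structure `J = φ - α₂ ⊗ Z₁ + α₁ ⊗ Z₂`. -/
noncomputable def J (x : M) : TangentSpace I x →L[ℝ] TangentSpace I x :=
  S.φ x - (S.α₂.toFun x).smulRight (S.Z₁ x) + (S.α₁.toFun x).smulRight (S.Z₂ x)

/-- The almost complex structure `T = φ + α₂ ⊗ Z₁ - α₁ ⊗ Z₂`. -/
noncomputable def T (x : M) : TangentSpace I x →L[ℝ] TangentSpace I x :=
  S.φ x + (S.α₂.toFun x).smulRight (S.Z₁ x) - (S.α₁.toFun x).smulRight (S.Z₂ x)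

/-- The structure is normal if both almost complex structures `J` and `T` are integrable. -/
def IsNormal : Prop := IsIntegrable S.J ∧ IsIntegrable S.T

/-- The Riemannian metric of `M` is associated to the structure, that is, `(M, S)` is a metric
contact pair manifold. -/
def IsAssociatedMetric [RiemannianBundle (fun x : M ↦ TangentSpace I x)] : Prop :=
  (∀ (x : M) (u v : TangentSpace I x),
    inner ℝ u (S.φ x v) = S.α₁.d x u v + S.α₂.d x u v) ∧
  (∀ (x : M) (u : TangentSpace I x), inner ℝ u (S.Z₁ x) = S.α₁.toFun x u) ∧
  (∀ (x : M) (u : TangentSpace I x), inner ℝ u (S.Z₂ x) = S.α₂.toFun x u)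

end AlmostContactPairStructure

end
end ContactPairGeometry

/-! Write `n` for the dimension and `Z = Z₁ + Z₂`. Two computations of the Ricci operator `Q` are
compared. Contracting the quasi-conformal tensor over an orthonormal basis gives `(a + b(n - 2)) (Q
- (scal / n) id) = 0`. The coefficient is nonzero, so `Q = (scal / n) id` at each point
(`ricciOp_of_flat`), with `scal` still an unknown function. The contact geometry determines that
function. Since `αᵢ(Z)` is constant and `i_Z dαᵢ = 0`, the flow of `Z` preserves `αᵢ` and `dαᵢ`.
Normality makes it preserve `φ` (`φ_mlieBracket`). The metric is determined by these data, so `Z` is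
Killing (`inner_nabla_reeb_skew`). As `α₁ + α₂` is dual to `Z`, the formula for `dα₁ + dα₂` then
yields `∇_v Z = -φ v` (`leviCivita_reeb`), hence `R(u, Z) Z = -φ² u` (`curvature_reeb_reeb`). The
trace of `-φ²` is `n - 2`, so `Ric(Z, Z) = n - 2` (`ricci_reeb_reeb`). As `g(Z, Z) = 2`, the two
results give `scal / n = (n - 2) / 2 = p + q` at every point; no Schur lemma is needed. Once `Q` is
this multiple of the identity, the terms in `b` cancel from the flatness equation, and `a ≠ 0`
leaves the curvature tensor of a space of constant curvature
(`hasConstantSectionalCurvature_of_flat`). Before that, the symmetries of the curvature tensor are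
derived from the Koszul formula. -/

namespace ContactPairGeometry

open VectorField Filter Topology

/-! ### Regularity of the manifold and smoothness of germs of vector fields. -/

section Regularity

variable {E : Type*} [NormedAddCommGroup E] [NormedSpace ℝ E] [FiniteDimensional ℝ E]
  {H : Type*} [TopologicalSpace H] {I : ModelWithCorners ℝ E H}
  {M : Type*} [TopologicalSpace M] [ChartedSpace H M] [IsManifold I ∞ M]

theorem isManifold_minSmoothness_two : IsManifold I (minSmoothness ℝ 2) M :=
  IsManifold.of_le (n := ∞) (by rw [minSmoothness_of_isRCLikeNormedField]; exact ENat.LEInfty.out)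

theorem isManifold_minSmoothness_three : IsManifold I (minSmoothness ℝ 3) M :=
  IsManifold.of_le (n := ∞) (by rw [minSmoothness_of_isRCLikeNormedField]; exact ENat.LEInfty.out)

end Regularity

attribute [local instance] isManifold_minSmoothness_two isManifold_minSmoothness_three

section Smoothness

variable {E : Type*} [NormedAddCommGroup E] [NormedSpace ℝ E] [FiniteDimensional ℝ E]
  {H : Type*} [TopologicalSpace H] {I : ModelWithCorners ℝ E H}
  {M : Type*} [TopologicalSpace M] [ChartedSpace H M] [IsManifold I ∞ M]

/-- The detour through `C^1` is needed because being `C^∞` at a point only gives, for each finite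
order, a neighbourhood that may depend on the order. This lemma turns identities valid under
differentiability into identities of germs, which can then be differentiated again; it is used
throughout because `FiberBundle.extend` is only known to be smooth at the base point. -/
theorem eventually_mdifferentiableAt {E' : Type*} [NormedAddCommGroup E'] [NormedSpace ℝ E']
    {H' : Type*} [TopologicalSpace H'] {I' : ModelWithCorners ℝ E' H'}
    {N : Type*} [TopologicalSpace N] [ChartedSpace H' N] [IsManifold I' ∞ N]
    {f : M → N} {x : M} (hf : ContMDiffAt I I' ∞ f x) :
    ∀ᶠ y in 𝓝 x, MDifferentiableAt I I' f y := by
  have h1 : ContMDiffAt I I' 1 f x := hf.of_le (by simp)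
  have := IsManifold.of_le (I := I) (M := M) (n := ∞) (m := 1) (by simp)
  have := IsManifold.of_le (I := I') (M := N) (n := ∞) (m := 1) (by simp)
  filter_upwards [(contMDiffAt_iff_contMDiffAt_nhds (by simp)).1 h1] with y hy
  exact hy.mdifferentiableAt (by simp)

theorem eventually_mdifferentiableAt_section {X : ∀ x : M, TangentSpace I x} {x : M}
    (hX : CMDiffAt ∞ (T% X) x) : ∀ᶠ y in 𝓝 x, MDiffAt (T% X) y :=
  eventually_mdifferentiableAt hX

theorem mdiff_of_smooth {X : ∀ x : M, TangentSpace I x} {x : M}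
    (hX : CMDiffAt ∞ (T% X) x) : MDiffAt (T% X) x :=
  hX.mdifferentiableAt (by simp)

theorem contMDiffAt_two {X : ∀ x : M, TangentSpace I x} {x : M}
    (hX : CMDiffAt ∞ (T% X) x) : CMDiffAt (minSmoothness ℝ 2) (T% X) x :=
  hX.of_le (by rw [minSmoothness_of_isRCLikeNormedField]; exact ENat.LEInfty.out)

theorem smooth_extend {x : M} (v : TangentSpace I x) :
    CMDiffAt ∞ (T% (FiberBundle.extend E v : ∀ y : M, TangentSpace I y)) x :=
  FiberBundle.contMDiffAt_extend ..

theorem smooth_mlieBracket {X Y : ∀ x : M, TangentSpace I x} {x : M}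
    (hX : CMDiffAt ∞ (T% X) x) (hY : CMDiffAt ∞ (T% Y) x) :
    CMDiffAt ∞ (T% (mlieBracket I X Y)) x := by
  have : IsManifold I (((⊤ : ℕ∞) : WithTop ℕ∞) + 1) M := ‹IsManifold I ∞ M›
  exact ContMDiffAt.mlieBracket_vectorField (n := (⊤ : ℕ∞)) (m := (⊤ : ℕ∞)) hX hY (by simp)

theorem smooth_det {n : Type*} [Fintype n] [DecidableEq n] {A : M → Matrix n n ℝ} {x : M}
    (hA : ∀ i j, CMDiffAt ∞ (fun y ↦ A y i j) x) : CMDiffAt ∞ (fun y ↦ (A y).det) x := by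
  simp only [Matrix.det_apply']
  refine contMDiffAt_finsetSum fun σ _ ↦ ContMDiffAt.mul contMDiffAt_const ?_
  exact contMDiffAt_finsetProd fun i _ ↦ hA _ _

end Smoothness

/-! ### Smoothness through the metric; vector fields as derivations. -/

section Metric

variable {E : Type*} [NormedAddCommGroup E] [NormedSpace ℝ E] [FiniteDimensional ℝ E]
  {H : Type*} [TopologicalSpace H] {I : ModelWithCorners ℝ E H}
  {M : Type*} [TopologicalSpace M] [ChartedSpace H M] [IsManifold I ∞ M]
  [RiemannianBundle (fun x : M ↦ TangentSpace I x)]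
  [IsContMDiffRiemannianBundle I ∞ E (fun x : M ↦ TangentSpace I x)]

theorem smooth_inner {X Y : ∀ x : M, TangentSpace I x} {x : M}
    (hX : CMDiffAt ∞ (T% X) x) (hY : CMDiffAt ∞ (T% Y) x) :
    CMDiffAt ∞ (fun y ↦ inner ℝ (X y) (Y y)) x :=
  ContMDiffAt.inner_bundle (IB := I) (F := E) (E := fun y : M ↦ TangentSpace I y)
    (b := fun y ↦ y) (v := X) (w := Y) hX hY

/-- A vector field is smooth at a point if its inner products with all smooth fields are. -/
theorem smooth_of_inner {s : ∀ x : M, TangentSpace I x} {x : M}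
    (h : ∀ Y : ∀ x : M, TangentSpace I x, CMDiffAt ∞ (T% Y) x →
      CMDiffAt ∞ (fun y ↦ inner ℝ (Y y) (s y)) x) :
    CMDiffAt ∞ (T% s) x := by
  let t := trivializationAt E (TangentSpace I : M → Type _) x
  let e := t.localFrame (Module.finBasis ℝ E)
  have hx : x ∈ t.baseSet := FiberBundle.mem_baseSet_trivializationAt ..
  have ht : t.baseSet ∈ 𝓝 x := t.open_baseSet.mem_nhds hx
  have hs : IsLocalFrameOn I E ∞ e t.baseSet := t.isLocalFrameOn_localFrame_baseSet I ∞ _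
  have he (i) : CMDiffAt ∞ (T% (e i)) x := hs.contMDiffAt t.open_baseSet hx i
  refine hs.contMDiffAt_of_coeff (fun i ↦ ?_) ht
  -- The local frame is not orthonormal, so the coefficients of `s` solve a linear system with the
  -- Gram matrix; Cramer's rule expresses them smoothly in the products `inner ℝ (e j y) (s y)`.
  let G (y : M) : Matrix _ _ ℝ := Matrix.gram ℝ fun i ↦ e i y
  have hG : ∀ i j, CMDiffAt ∞ (fun y ↦ G y i j) x := fun i j ↦ smooth_inner (he i) (he j)
  have hdet : ∀ y ∈ t.baseSet, (G y).det ≠ 0 := fun y hy ↦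
    (Matrix.posDef_gram_of_linearIndependent (hs.linearIndependent hy)).det_pos.ne'
  have key : ∀ y ∈ t.baseSet, hs.coeff i y (s y) =
      ((G y).updateCol i fun j ↦ inner ℝ (e j y) (s y)).det / (G y).det := by
    intro y hy
    have h1 : (fun j ↦ inner ℝ (e j y) (s y)) = (G y).mulVec fun k ↦ hs.coeff k y (s y) := by
      ext j
      conv_lhs => rw [hs.coeff_sum_eq s hy]
      simp [inner_sum, Matrix.mulVec, dotProduct, G, Matrix.gram_apply, inner_smul_right, mul_comm]
    rw [eq_div_iff (hdet y hy), ← Matrix.cramer_apply, h1, Matrix.cramer_eq_adjugate_mulVec,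
      Matrix.mulVec_mulVec, Matrix.adjugate_mul]
    simp [Matrix.smul_mulVec, mul_comm]
  refine ContMDiffAt.congr_of_eventuallyEq (f := fun y ↦
    ((G y).updateCol i fun j ↦ inner ℝ (e j y) (s y)).det / (G y).det) ?_
    (by filter_upwards [ht] with y hy using key y hy)
  refine ContMDiffAt.div₀ (smooth_det fun j k ↦ ?_) (smooth_det hG) (hdet x hx)
  by_cases hk : k = i
  · subst hk; simpa using h _ (he j)
  · simpa [Matrix.updateCol_ne hk] using hG j k

/-- The derivative is recovered from brackets: `[X, f W] = (X f) W + f [X, W]`, so pairing with a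
field `W` that is nonzero at `x` writes `X f` as a quotient of smooth functions. Such a `W` exists
unless the model space is trivial. -/
theorem smooth_mvfderiv {f : M → ℝ} {X : ∀ x : M, TangentSpace I x} {x : M}
    (hf : CMDiffAt ∞ f x) (hX : CMDiffAt ∞ (T% X) x) :
    CMDiffAt ∞ (fun y ↦ mvfderiv I f y (X y)) x := by
  rcases subsingleton_or_nontrivial E with hE | hE
  · have (y : M) : mvfderiv I f y (X y) = 0 := by
      have : X y = 0 := hE.elim (α := E) _ _
      simp [this]
    simp only [this]
    exact contMDiffAt_const
  obtain ⟨w, hw⟩ : ∃ w : TangentSpace I x, w ≠ 0 := exists_ne (0 : E)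
  let W : ∀ y : M, TangentSpace I y := FiberBundle.extend E w
  have hW : CMDiffAt ∞ (T% W) x := smooth_extend _
  have hWx : inner ℝ (W x) (W x) ≠ 0 := by
    simpa [W] using hw
  have h1 : CMDiffAt ∞ (fun y ↦ (inner ℝ (W y) (mlieBracket I X (f • W) y) -
      f y * inner ℝ (W y) (mlieBracket I X W y)) / inner ℝ (W y) (W y)) x :=
    ((smooth_inner hW (smooth_mlieBracket hX (hf.smul_section hW))).sub
      (hf.mul (smooth_inner hW (smooth_mlieBracket hX hW)))).div₀ (smooth_inner hW hW) hWx
  refine h1.congr_of_eventuallyEq ?_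
  filter_upwards [eventually_mdifferentiableAt hf, eventually_mdifferentiableAt_section hW,
    (smooth_inner hW hW).continuousAt.eventually_ne hWx] with y hfy hWy hy
  rw [mlieBracket_smul_right hfy hWy, eq_div_iff hy]
  simp [inner_add_right, inner_smul_right]

/-- The Lie bracket acts on functions as the commutator of derivations. -/
theorem mvfderiv_mlieBracket {f : M → ℝ} {X Y : ∀ x : M, TangentSpace I x} {x : M}
    (hf : CMDiffAt ∞ f x) (hX : CMDiffAt ∞ (T% X) x) (hY : CMDiffAt ∞ (T% Y) x) :
    mvfderiv I f x (mlieBracket I X Y x) =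
      mvfderiv I (fun y ↦ mvfderiv I f y (Y y)) x (X x) -
      mvfderiv I (fun y ↦ mvfderiv I f y (X y)) x (Y x) := by
  rcases subsingleton_or_nontrivial E with hE | hE
  · have (y : M) (v : TangentSpace I y) : v = 0 := hE.elim (α := E) _ _
    simp [this x (X x), this x (Y x), this x (mlieBracket I X Y x)]
  obtain ⟨w, hw⟩ : ∃ w : TangentSpace I x, w ≠ 0 := exists_ne (0 : E)
  let W : ∀ y : M, TangentSpace I y := FiberBundle.extend E w
  have hW : CMDiffAt ∞ (T% W) x := smooth_extend _
  have hWx : W x ≠ 0 := by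
    simpa [W] using hw
  -- The Jacobi identity is applied to `X`, `Y`, `f W` and to `X`, `Y`, `W`. After expansion by the
  -- Leibniz rule, their comparison leaves only a multiple of `W x`, whose coefficient is the defect
  -- in the claimed formula.
  have expand {A B : ∀ x : M, TangentSpace I x} (hA : CMDiffAt ∞ (T% A) x)
      (hB : CMDiffAt ∞ (T% B) x) : mlieBracket I A (mlieBracket I B (f • W)) x =
      mvfderiv I (fun y ↦ mvfderiv I f y (B y)) x (A x) • W x
      + mvfderiv I f x (B x) • mlieBracket I A W x
      + (mvfderiv I f x (A x) • mlieBracket I B W x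
      + f x • mlieBracket I A (mlieBracket I B W) x) := by
    have h1 : mlieBracket I B (f • W) =ᶠ[𝓝 x]
        (fun y ↦ mvfderiv I f y (B y)) • W + f • mlieBracket I B W := by
      filter_upwards [eventually_mdifferentiableAt hf, eventually_mdifferentiableAt_section hW]
        with y hfy hWy
      rw [mlieBracket_smul_right hfy hWy]
      rfl
    have h2 : CMDiffAt ∞ (T% ((fun y ↦ mvfderiv I f y (B y)) • W)) x :=
      (smooth_mvfderiv hf hB).smul_section hW
    have h3 : CMDiffAt ∞ (T% (f • mlieBracket I B W)) x :=
      hf.smul_section (smooth_mlieBracket hB hW)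
    rw [EventuallyEq.mlieBracket_vectorField_eq (V₁ := A) (V := A) EventuallyEq.rfl h1,
      mlieBracket_add_right (mdiff_of_smooth h2) (mdiff_of_smooth h3),
      mlieBracket_smul_right ((smooth_mvfderiv hf hB).mdifferentiableAt (by simp))
        (mdiff_of_smooth hW),
      mlieBracket_smul_right (hf.mdifferentiableAt (by simp))
        (mdiff_of_smooth (smooth_mlieBracket hB hW))]
  have h1 := leibniz_identity_mlieBracket_apply (contMDiffAt_two hX) (contMDiffAt_two hY)
    (contMDiffAt_two (X := f • W) (hf.smul_section hW))
  have h2 := leibniz_identity_mlieBracket_apply (contMDiffAt_two hX) (contMDiffAt_two hY)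
    (contMDiffAt_two hW)
  rw [expand hX hY, expand hY hX, mlieBracket_smul_right (hf.mdifferentiableAt (by simp))
        (mdiff_of_smooth hW), h2] at h1
  have h3 : (mvfderiv I f x (mlieBracket I X Y x) -
      (mvfderiv I (fun y ↦ mvfderiv I f y (Y y)) x (X x) -
      mvfderiv I (fun y ↦ mvfderiv I f y (X y)) x (Y x))) • W x = 0 := by
    rw [← sub_eq_zero] at h1
    rw [← neg_eq_zero, ← h1]
    module
  exact sub_eq_zero.1 ((smul_eq_zero.1 h3).resolve_right hWx)

end Metric

/-! ### Symmetries and tensoriality of the Riemann curvature. -/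

section Curvature

variable {E : Type*} [NormedAddCommGroup E] [NormedSpace ℝ E] [FiniteDimensional ℝ E]
  {H : Type*} [TopologicalSpace H] {I : ModelWithCorners ℝ E H}
  {M : Type*} [TopologicalSpace M] [ChartedSpace H M] [IsManifold I ∞ M]
  [RiemannianBundle (fun x : M ↦ TangentSpace I x)]
  [IsContMDiffRiemannianBundle I ∞ E (fun x : M ↦ TangentSpace I x)]

/-- The covariant derivative `∇_X Y` as a vector field. -/
noncomputable def nabla (X Y : ∀ x : M, TangentSpace I x) (x : M) : TangentSpace I x :=
  leviCivita I M Y x (X x)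

/-- The Koszul formula expresses the products of `∇_X Y` with smooth fields by derivatives, brackets
and inner products, all smooth; `smooth_of_inner` then applies. -/
theorem smooth_nabla {X Y : ∀ x : M, TangentSpace I x} {x : M}
    (hX : CMDiffAt ∞ (T% X) x) (hY : CMDiffAt ∞ (T% Y) x) :
    CMDiffAt ∞ (T% (nabla X Y)) x := by
  refine smooth_of_inner fun Z hZ ↦ ?_
  have h1 : CMDiffAt ∞ (koszul X Y Z) x := by
    unfold koszul
    exact contMDiffAt_const.mul ((((((smooth_mvfderiv (smooth_inner hY hZ) hX).add
      (smooth_mvfderiv (smooth_inner hX hZ) hY)).sub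
      (smooth_mvfderiv (smooth_inner hX hY) hZ)).add
      (smooth_inner (smooth_mlieBracket hX hY) hZ)).sub
      (smooth_inner (smooth_mlieBracket hX hZ) hY)).sub
      (smooth_inner (smooth_mlieBracket hY hZ) hX))
  refine h1.congr_of_eventuallyEq ?_
  filter_upwards [eventually_mdifferentiableAt_section hX, eventually_mdifferentiableAt_section hY,
    eventually_mdifferentiableAt_section hZ] with y hXy hYy hZy
  rw [real_inner_comm]
  exact inner_leviCivitaFun hXy hYy hZy

theorem mvfderiv_congr {f g : M → ℝ} {x : M} (h : f =ᶠ[𝓝 x] g) :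
    mvfderiv I f x = mvfderiv I g x := by
  ext v
  exact congrArg (fun L : TangentSpace I x →L[ℝ] ℝ ↦ L v) h.mfderiv_eq

theorem nabla_congr_right {X Y Y' : ∀ x : M, TangentSpace I x} {x : M}
    (hY : MDiffAt (T% Y) x) (h : Y =ᶠ[𝓝 x] Y') : nabla X Y x = nabla X Y' x := by
  have hY' : MDiffAt (T% Y') x :=
    hY.congr_of_eventuallyEq (by filter_upwards [h] with y hy; rw [hy])
  have := (leviCivita I M).isCovariantDerivativeOnUniv.congr_of_eventuallyEq hY hY' univ_mem h
  exact congrArg (· (X x)) this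

theorem nabla_sub_right {X Y Y' : ∀ x : M, TangentSpace I x} {x : M}
    (hY : MDiffAt (T% Y) x) (hY' : MDiffAt (T% Y') x) :
    nabla X (Y - Y') x = nabla X Y x - nabla X Y' x := by
  have h1 : MDiffAt (T% (Y - Y')) x := mdifferentiableAt_sub_section hY hY'
  have h2 := (leviCivita I M).isCovariantDerivativeOnUniv.add h1 hY'
  rw [sub_add_cancel] at h2
  simp only [nabla]
  rw [eq_sub_iff_add_eq]
  exact (congrArg (· (X x)) h2).symm

theorem nabla_sub_nabla {X Y : ∀ x : M, TangentSpace I x} {x : M}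
    (hX : MDiffAt (T% X) x) (hY : MDiffAt (T% Y) x) :
    nabla X Y x - nabla Y X x = mlieBracket I X Y x :=
  leviCivita_torsion hX hY

theorem mvfderiv_inner {X Y Z : ∀ x : M, TangentSpace I x} {x : M}
    (hX : MDiffAt (T% X) x) (hY : MDiffAt (T% Y) x) (hZ : MDiffAt (T% Z) x) :
    mvfderiv I (fun y ↦ inner ℝ (Y y) (Z y)) x (X x) =
      inner ℝ (nabla X Y x) (Z x) + inner ℝ (Y x) (nabla X Z x) :=
  leviCivita_metric hX hY hZ

/-- The Riemann curvature `R(U, V) W` computed on vector fields. -/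
noncomputable def curvatureField (U V W : ∀ x : M, TangentSpace I x) (x : M) : TangentSpace I x :=
  nabla U (nabla V W) x - nabla V (nabla U W) x - nabla (mlieBracket I U V) W x

theorem curvatureField_swap (U V W : ∀ x : M, TangentSpace I x) (x : M) :
    curvatureField U V W x = - curvatureField V U W x := by
  have h : nabla (mlieBracket I U V) W x = - nabla (mlieBracket I V U) W x := by
    rw [nabla, nabla, mlieBracket_swap_apply, map_neg]
  rw [curvatureField, curvatureField, h]
  abel

variable {U V W Y : ∀ x : M, TangentSpace I x} {x : M}

theorem mvfderiv_mvfderiv_inner (hU : CMDiffAt ∞ (T% U) x) (hV : CMDiffAt ∞ (T% V) x)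
    (hW : CMDiffAt ∞ (T% W) x) (hY : CMDiffAt ∞ (T% Y) x) :
    mvfderiv I (fun y ↦ mvfderiv I (fun z ↦ inner ℝ (W z) (Y z)) y (V y)) x (U x) =
      inner ℝ (nabla U (nabla V W) x) (Y x) + inner ℝ (nabla V W x) (nabla U Y x)
      + (inner ℝ (nabla U W x) (nabla V Y x) + inner ℝ (W x) (nabla U (nabla V Y) x)) := by
  have h1 : (fun y ↦ mvfderiv I (fun z ↦ inner ℝ (W z) (Y z)) y (V y)) =ᶠ[𝓝 x]
      (fun y ↦ inner ℝ (nabla V W y) (Y y) + inner ℝ (W y) (nabla V Y y)) := by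
    filter_upwards [eventually_mdifferentiableAt_section hV,
      eventually_mdifferentiableAt_section hW, eventually_mdifferentiableAt_section hY]
      with y h1 h2 h3 using mvfderiv_inner h1 h2 h3
  have hU' := mdiff_of_smooth hU
  have hW' := mdiff_of_smooth hW
  have hY' := mdiff_of_smooth hY
  have hVW := mdiff_of_smooth (smooth_nabla hV hW)
  have hVY := mdiff_of_smooth (smooth_nabla hV hY)
  rw [mvfderiv_congr h1, mvfderiv_fun_add (mdiff_inner hVW hY')
    (mdiff_inner hW' hVY), add_apply, mvfderiv_inner hU' hVW hY', mvfderiv_inner hU' hW' hVY]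

/-- Differentiate `g(W, Y)` along `V` and `U` and antisymmetrize: the mixed products of first
derivatives cancel, and the commutator of derivations is the derivative along `[U, V]`. -/
theorem inner_curvatureField_skew (hU : CMDiffAt ∞ (T% U) x) (hV : CMDiffAt ∞ (T% V) x)
    (hW : CMDiffAt ∞ (T% W) x) (hY : CMDiffAt ∞ (T% Y) x) :
    inner ℝ (curvatureField U V W x) (Y x) = - inner ℝ (curvatureField U V Y x) (W x) := by
  have h1 := mvfderiv_mvfderiv_inner hU hV hW hY
  have h2 := mvfderiv_mvfderiv_inner hV hU hW hY
  have h3 := mvfderiv_mlieBracket (smooth_inner hW hY) hU hV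
  have h4 := mvfderiv_inner (mdiff_of_smooth (smooth_mlieBracket hU hV)) (mdiff_of_smooth hW)
    (mdiff_of_smooth hY)
  simp only [curvatureField, inner_sub_left]
  rw [real_inner_comm (W x), real_inner_comm (W x), real_inner_comm (W x)]
  linarith

/-- Vanishing torsion, used twice, turns `∇_A ∇_B C - ∇_A ∇_C B - ∇_[B,C] A` into `[A, [B, C]]`; the
cyclic sum is then the Jacobi identity. -/
theorem curvatureField_cyclic (hU : CMDiffAt ∞ (T% U) x) (hV : CMDiffAt ∞ (T% V) x)
    (hW : CMDiffAt ∞ (T% W) x) :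
    curvatureField U V W x + curvatureField V W U x + curvatureField W U V x = 0 := by
  have key {A B C : ∀ x : M, TangentSpace I x} (hA : CMDiffAt ∞ (T% A) x)
      (hB : CMDiffAt ∞ (T% B) x) (hC : CMDiffAt ∞ (T% C) x) :
      nabla A (nabla B C) x - nabla A (nabla C B) x - nabla (mlieBracket I B C) A x =
        mlieBracket I A (mlieBracket I B C) x := by
    have h1 : nabla B C - nabla C B =ᶠ[𝓝 x] mlieBracket I B C := by
      filter_upwards [eventually_mdifferentiableAt_section hB,
        eventually_mdifferentiableAt_section hC] with y h1 h2 using nabla_sub_nabla h1 h2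
    have h2 := mdiff_of_smooth (smooth_nabla hB hC)
    have h3 := mdiff_of_smooth (smooth_nabla hC hB)
    rw [← nabla_sub_right h2 h3, nabla_congr_right (mdifferentiableAt_sub_section h2 h3) h1,
      nabla_sub_nabla (mdiff_of_smooth hA) (mdiff_of_smooth (smooth_mlieBracket hB hC))]
  have h1 := key hU hV hW
  have h2 := key hV hW hU
  have h3 := key hW hU hV
  have h4 := leibniz_identity_mlieBracket_apply (contMDiffAt_two hU) (contMDiffAt_two hV)
    (contMDiffAt_two hW)
  rw [mlieBracket_swap_apply (V := mlieBracket I U V) (W := W)] at h4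
  have h5 : mlieBracket I V (mlieBracket I U W) x = - mlieBracket I V (mlieBracket I W U) x := by
    have : mlieBracket I U W = (-1 : ℝ) • mlieBracket I W U := by
      rw [mlieBracket_swap, neg_one_smul]
    rw [this, mlieBracket_const_smul_right (mdiff_of_smooth (smooth_mlieBracket hW hU)),
      neg_one_smul]
  rw [h5, ← h1, ← h2, ← h3] at h4
  simp only [curvatureField]
  rw [← sub_eq_zero] at h4
  rw [← h4]
  abel

/-- The classical octahedron argument: the four Bianchi identities omitting one field each are
combined by means of the two skew symmetries. -/
theorem inner_curvatureField_pair (hU : CMDiffAt ∞ (T% U) x) (hV : CMDiffAt ∞ (T% V) x)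
    (hW : CMDiffAt ∞ (T% W) x) (hY : CMDiffAt ∞ (T% Y) x) :
    inner ℝ (curvatureField U V W x) (Y x) = inner ℝ (curvatureField W Y U x) (V x) := by
  have cyc {A B C D : ∀ x : M, TangentSpace I x} (hA : CMDiffAt ∞ (T% A) x)
      (hB : CMDiffAt ∞ (T% B) x) (hC : CMDiffAt ∞ (T% C) x) :
      inner ℝ (curvatureField A B C x) (D x) + inner ℝ (curvatureField B C A x) (D x) +
        inner ℝ (curvatureField C A B x) (D x) = 0 := by
    rw [← inner_add_left, ← inner_add_left, curvatureField_cyclic hA hB hC, inner_zero_left]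
  have sw (A B C D : ∀ x : M, TangentSpace I x) :
      inner ℝ (curvatureField A B C x) (D x) = - inner ℝ (curvatureField B A C x) (D x) := by
    rw [curvatureField_swap, inner_neg_left]
  have a1 := cyc hU hV hW (D := Y)
  have a2 := cyc hV hW hY (D := U)
  have a3 := cyc hW hY hU (D := V)
  have a4 := cyc hY hU hV (D := W)
  linarith [inner_curvatureField_skew hU hV hW hY, inner_curvatureField_skew hV hW hU hY,
    inner_curvatureField_skew hW hU hV hY, inner_curvatureField_skew hY hV hW hU,
    inner_curvatureField_skew hW hY hV hU, inner_curvatureField_skew hY hU hW hV,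
    sw W U V Y, sw V W Y U, sw V Y W U, sw U W Y V, sw Y U V W, sw V Y U W]

theorem curvature_eq_extend (u v w : TangentSpace I x) :
    curvature x u v w = curvatureField (FiberBundle.extend E u) (FiberBundle.extend E v)
      (FiberBundle.extend E w) x := by
  simp only [curvature, curvatureField, nabla, FiberBundle.extend_apply_self]
  rfl

/-- The curvature at a point can be computed with any smooth extensions. -/
theorem curvature_eq (hU : CMDiffAt ∞ (T% U) x) (hV : CMDiffAt ∞ (T% V) x)
    (hW : CMDiffAt ∞ (T% W) x) : curvature x (U x) (V x) (W x) = curvatureField U V W x := by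
  -- Tensoriality follows from the symmetries: skewness moves `C` into the second slot of the inner
  -- product, where only its value at `x` matters. Pair symmetry carries this over to the first
  -- slot, and antisymmetry to the second.
  have third {A B C C' : ∀ x : M, TangentSpace I x} (hA : CMDiffAt ∞ (T% A) x)
      (hB : CMDiffAt ∞ (T% B) x) (hC : CMDiffAt ∞ (T% C) x) (hC' : CMDiffAt ∞ (T% C') x)
      (h : C x = C' x) : curvatureField A B C x = curvatureField A B C' x := by
    refine ext_inner_right ℝ fun v ↦ ?_
    have hv := smooth_extend (I := I) v
    rw [← FiberBundle.extend_apply_self (F := E) v, inner_curvatureField_skew hA hB hC hv,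
      inner_curvatureField_skew hA hB hC' hv, h]
  have first {A A' B C : ∀ x : M, TangentSpace I x} (hA : CMDiffAt ∞ (T% A) x)
      (hA' : CMDiffAt ∞ (T% A') x) (hB : CMDiffAt ∞ (T% B) x) (hC : CMDiffAt ∞ (T% C) x)
      (h : A x = A' x) : curvatureField A B C x = curvatureField A' B C x := by
    refine ext_inner_right ℝ fun v ↦ ?_
    have hv := smooth_extend (I := I) v
    rw [← FiberBundle.extend_apply_self (F := E) v, inner_curvatureField_pair hA hB hC hv,
      inner_curvatureField_pair hA' hB hC hv, third hC hv hA hA' h]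
  have eU := smooth_extend (I := I) (U x)
  have eV := smooth_extend (I := I) (V x)
  have eW := smooth_extend (I := I) (W x)
  rw [curvature_eq_extend, first eU hU eV eW (by simp), curvatureField_swap,
    first eV hV hU eW (by simp),
    ← curvatureField_swap, third hU hV eW hW (by simp)]

theorem inner_curvature_skew (u v w y : TangentSpace I x) :
    inner ℝ (curvature x u v w) y = - inner ℝ (curvature x u v y) w := by
  have h := inner_curvatureField_skew (smooth_extend (I := I) u) (smooth_extend (I := I) v)
    (smooth_extend (I := I) w) (smooth_extend (I := I) y)
  rw [FiberBundle.extend_apply_self, FiberBundle.extend_apply_self] at h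
  simpa only [← curvature_eq_extend] using h

theorem inner_curvature_pair (u v w y : TangentSpace I x) :
    inner ℝ (curvature x u v w) y = inner ℝ (curvature x w y u) v := by
  have h := inner_curvatureField_pair (smooth_extend (I := I) u) (smooth_extend (I := I) v)
    (smooth_extend (I := I) w) (smooth_extend (I := I) y)
  rw [FiberBundle.extend_apply_self, FiberBundle.extend_apply_self] at h
  simpa only [← curvature_eq_extend] using h

variable (x) in
/-- `u ↦ R(u, v) w` as a linear map. -/
noncomputable def curvatureLin (v w : TangentSpace I x) :
    TangentSpace I x →ₗ[ℝ] TangentSpace I x where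
  toFun u := curvature x u v w
  -- Since `curvature` is defined through chosen extensions, linearity is not immediate; the
  -- symmetries give `g(R(u, v) w, y) = -g(R(w, y) v, u)`, visibly linear in `u`.
  map_add' u u' := ext_inner_right ℝ fun y ↦ by
    rw [inner_add_left, inner_curvature_pair, inner_curvature_skew, inner_curvature_pair u,
      inner_curvature_skew _ _ u, inner_curvature_pair u', inner_curvature_skew _ _ u',
      inner_add_right, neg_add]
  map_smul' c u := ext_inner_right ℝ fun y ↦ by
    rw [RingHom.id_apply, inner_smul_left, inner_curvature_pair, inner_curvature_skew,
      inner_curvature_pair u, inner_curvature_skew _ _ u, inner_smul_right]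
    simp

end Curvature

/-! ### Traces of the quasi-conformal curvature tensor. -/

section Contraction

variable {E : Type*} [NormedAddCommGroup E] [NormedSpace ℝ E] [FiniteDimensional ℝ E]
  {H : Type*} [TopologicalSpace H] {I : ModelWithCorners ℝ E H}
  {M : Type*} [TopologicalSpace M] [ChartedSpace H M] [IsManifold I ∞ M]
  [RiemannianBundle (fun x : M ↦ TangentSpace I x)]
  [IsContMDiffRiemannianBundle I ∞ E (fun x : M ↦ TangentSpace I x)]
  {x : M}

theorem ricci_eq_sum (u v : TangentSpace I x) :
    haveI := finiteDimensional_tangentSpace (I := I) x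
    ricci x u v = ∑ i, inner ℝ (curvature x (stdOrthonormalBasis ℝ (TangentSpace I x) i) v u)
      (stdOrthonormalBasis ℝ (TangentSpace I x) i) := by
  simp only [ricci, ricciOp, sum_inner]
  exact Finset.sum_congr rfl fun i _ ↦ inner_curvature_pair ..

variable (I x) in
/-- The Ricci operator as a linear map. -/
noncomputable def ricciLin : TangentSpace I x →ₗ[ℝ] TangentSpace I x :=
  haveI := finiteDimensional_tangentSpace (I := I) x
  ∑ i, curvatureLin x (stdOrthonormalBasis ℝ (TangentSpace I x) i)
    (stdOrthonormalBasis ℝ (TangentSpace I x) i)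

theorem ricciLin_apply (u : TangentSpace I x) : ricciLin I x u = ricciOp x u := by
  simp [ricciLin, ricciOp, LinearMap.sum_apply, curvatureLin]

/-- The trace of the quasi-conformal curvature tensor is a multiple of the trace-free part of the
Ricci operator. -/
theorem ricciOp_of_flat {a b : ℝ} (hn : 2 ≤ Module.finrank ℝ E)
    (hab : a + b * ((Module.finrank ℝ E : ℝ) - 2) ≠ 0) (hflat : IsQuasiConformallyFlat I M a b)
    (u : TangentSpace I x) :
    ricciOp x u = (scalarCurvature I x / (Module.finrank ℝ E : ℝ)) • u := by
  have := finiteDimensional_tangentSpace (I := I) x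
  set n : ℝ := (Module.finrank ℝ E : ℝ) with hn_def
  have hn2 : (2 : ℝ) ≤ n := by rw [hn_def]; exact_mod_cast hn
  let e := stdOrthonormalBasis ℝ (TangentSpace I x)
  have hcard : (Fintype.card (Fin (Module.finrank ℝ (TangentSpace I x))) : ℝ) = n := by
    rw [Fintype.card_fin]; rfl
  have h1 : ∑ i, ricci x (e i) (e i) = scalarCurvature I x := rfl
  have h2 : ∑ i, curvature x u (e i) (e i) = ricciOp x u := rfl
  have expand (v : TangentSpace I x) : ∑ i, (inner ℝ v (e i) : ℝ) • e i = v := by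
    simpa [real_inner_comm] using e.sum_repr' v
  have h3 : ∑ i, ricci x u (e i) • e i = ricciOp x u := expand _
  have h4 : ∑ i, (inner ℝ u (e i) : ℝ) • ricciOp x (e i) = ricciOp x u := by
    conv_rhs => rw [← ricciLin_apply, ← expand u, map_sum]
    simp [ricciLin_apply]
  have h5 : ∀ i, (inner ℝ (e i) (e i) : ℝ) = 1 := fun i ↦ by simp
  -- The trace is `a Q u + b (scal u + (n - 2) Q u) - (scal / n) (a + 2 b (n - 1)) u`, which factors
  -- as `(a + b (n - 2)) (Q u - (scal / n) u)`.
  have key : ∑ i, quasiConformalCurvature a b x u (e i) (e i) = 0 :=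
    Finset.sum_eq_zero fun i _ ↦ hflat ..
  simp only [quasiConformalCurvature, Finset.sum_sub_distrib, Finset.sum_add_distrib,
    ← Finset.smul_sum, ← Finset.sum_smul, h1, h2, h3, h4, h5, expand, one_smul,
    Finset.sum_const, Finset.card_univ, ← Nat.cast_smul_eq_nsmul ℝ, hcard] at key
  rw [← hn_def] at key
  have hn0 : n ≠ 0 := by linarith
  have hn1 : n - 1 ≠ 0 := by linarith
  have : (a + b * (n - 2)) • (ricciOp x u - (scalarCurvature I x / n) • u) = 0 := by
    rw [← key]
    match_scalars <;> field_simp <;> ring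
  exact sub_eq_zero.1 ((smul_eq_zero.1 this).resolve_left hab)

/-- A quasi-conformally flat Einstein manifold with `a ≠ 0` has constant curvature. -/
theorem hasConstantSectionalCurvature_of_flat {a b c : ℝ} (hn : 2 ≤ Module.finrank ℝ E)
    (ha : a ≠ 0) (hflat : IsQuasiConformallyFlat I M a b)
    (hQ : ∀ (x : M) (u : TangentSpace I x), ricciOp x u = c • u)
    (hs : ∀ x : M, scalarCurvature I x = (Module.finrank ℝ E : ℝ) * c) :
    HasConstantSectionalCurvature I M (c / ((Module.finrank ℝ E : ℝ) - 1)) := by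
  intro x u v huv
  set n : ℝ := (Module.finrank ℝ E : ℝ) with hn_def
  have hn2 : (2 : ℝ) ≤ n := by rw [hn_def]; exact_mod_cast hn
  have hn0 : n ≠ 0 := by linarith
  have hn1 : n - 1 ≠ 0 := by linarith
  -- The denominator of the sectional curvature is the Gram determinant of `u`, `v`.
  have hdet : inner ℝ u u * inner ℝ v v - inner ℝ u v ^ 2 ≠ 0 := by
    have := (Matrix.posDef_gram_of_linearIndependent huv).det_pos.ne'
    rw [Matrix.det_fin_two] at this
    simpa [Matrix.gram_apply, real_inner_comm u v, pow_two] using this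
  have h := congrArg (fun w ↦ (inner ℝ w u : ℝ)) (hflat x u v v)
  simp only [quasiConformalCurvature, ricci, hQ, hs, inner_add_left, inner_sub_left,
    inner_smul_left, inner_zero_left, ← hn_def] at h
  rw [real_inner_comm u v] at h
  simp only [conj_trivial] at h
  rw [sectionalCurvature, div_eq_div_iff hdet hn1]
  -- With `Q = c` and `scal = n c` the Ricci terms contribute `2 b c` and the scalar term `-2 b c`,
  -- so every remaining term carries the factor `a`.
  apply mul_left_cancel₀ ha
  field_simp at h
  linear_combination h

end Contraction

/-! ### Invariance of a form and its differential along a Reeb-type field. -/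

section Contact

variable {E : Type*} [NormedAddCommGroup E] [NormedSpace ℝ E] [FiniteDimensional ℝ E]
  {H : Type*} [TopologicalSpace H] {I : ModelWithCorners ℝ E H}
  {M : Type*} [TopologicalSpace M] [ChartedSpace H M] [IsManifold I ∞ M]
  [RiemannianBundle (fun x : M ↦ TangentSpace I x)]
  [IsContMDiffRiemannianBundle I ∞ E (fun x : M ↦ TangentSpace I x)]
  {x : M}

namespace SmoothOneForm

variable {α : SmoothOneForm I M} {X Y Z : ∀ x : M, TangentSpace I x}

theorem smooth_apply (α : SmoothOneForm I M) (hX : CMDiffAt ∞ (T% X) x) :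
    CMDiffAt ∞ (fun y ↦ α.toFun y (X y)) x := by
  have : ContMDiffAt I (I.prod 𝓘(ℝ, ℝ)) ∞
      (fun m ↦ TotalSpace.mk' ℝ (E := Bundle.Trivial M ℝ) m (α.toFun m (X m))) x :=
    ContMDiffAt.clm_bundle_apply (F₁ := E) (α.contMDiff x) hX
  simp only [contMDiffAt_totalSpace] at this
  exact this.2

/-- A field annihilating `dα` on which `α` is constant preserves `α`. -/
theorem apply_mlieBracket {c : ℝ} (hc : ∀ y, α.toFun y (Z y) = c)
    (hd : ∀ y v, α.d y (Z y) v = 0) (hZ : MDiffAt (T% Z) x) (hX : MDiffAt (T% X) x) :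
    α.toFun x (mlieBracket I Z X x) = mvfderiv I (fun y ↦ α.toFun y (X y)) x (Z x) := by
  -- Cartan's formula in disguise: `L_Z α = d(α(Z)) + i_Z dα` up to normalization, and both terms
  -- vanish.
  have h := α.d_apply hZ hX
  simp only [hd, hc, mvfderiv_const] at h
  simp at h
  linarith

theorem d_eventuallyEq (hX : CMDiffAt ∞ (T% X) x) (hY : CMDiffAt ∞ (T% Y) x) :
    (fun y ↦ α.d y (X y) (Y y)) =ᶠ[𝓝 x]
      fun y ↦ (1 / 2) * (mvfderiv I (fun y ↦ α.toFun y (Y y)) y (X y)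
      - mvfderiv I (fun y ↦ α.toFun y (X y)) y (Y y)
      - α.toFun y (mlieBracket I X Y y)) := by
  filter_upwards [eventually_mdifferentiableAt_section hX,
    eventually_mdifferentiableAt_section hY] with y h1 h2 using α.d_apply h1 h2

theorem smooth_d_apply (α : SmoothOneForm I M) (hX : CMDiffAt ∞ (T% X) x)
    (hY : CMDiffAt ∞ (T% Y) x) : CMDiffAt ∞ (fun y ↦ α.d y (X y) (Y y)) x :=
  (contMDiffAt_const.mul (((smooth_mvfderiv (α.smooth_apply hY) hX).sub
    (smooth_mvfderiv (α.smooth_apply hX) hY)).sub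
    (α.smooth_apply (smooth_mlieBracket hX hY)))).congr_of_eventuallyEq (d_eventuallyEq hX hY)

/-- A field annihilating `dα` on which `α` is constant preserves `dα`. -/
theorem mvfderiv_d {c : ℝ} (hc : ∀ y, α.toFun y (Z y) = c)
    (hd : ∀ y v, α.d y (Z y) v = 0) (hZ : CMDiffAt ∞ (T% Z) x) (hX : CMDiffAt ∞ (T% X) x)
    (hY : CMDiffAt ∞ (T% Y) x) :
    mvfderiv I (fun y ↦ α.d y (X y) (Y y)) x (Z x) =
      α.d x (mlieBracket I Z X x) (Y x) + α.d x (X x) (mlieBracket I Z Y x) := by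
  have hZX := smooth_mlieBracket hZ hX
  have hZY := smooth_mlieBracket hZ hY
  have hXY := smooth_mlieBracket hX hY
  have near {W : ∀ x : M, TangentSpace I x} (hW : CMDiffAt ∞ (T% W) x) :
      (fun y ↦ α.toFun y (mlieBracket I Z W y)) =ᶠ[𝓝 x]
        fun y ↦ mvfderiv I (fun y ↦ α.toFun y (W y)) y (Z y) := by
    filter_upwards [eventually_mdifferentiableAt_section hZ,
      eventually_mdifferentiableAt_section hW] with y h1 h2 using apply_mlieBracket hc hd h1 h2
  have s1 := (smooth_mvfderiv (α.smooth_apply hY) hX).mdifferentiableAt (by simp)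
  have s2 := (smooth_mvfderiv (α.smooth_apply hX) hY).mdifferentiableAt (by simp)
  have s3 := (α.smooth_apply hXY).mdifferentiableAt (by simp)
  have comb {f g h : M → ℝ} (hf : MDiffAt f x) (hg : MDiffAt g x) (hh : MDiffAt h x) :
      mvfderiv I (fun y ↦ (1 / 2) * (f y - g y - h y)) x =
        (1 / 2 : ℝ) • (mvfderiv I f x - mvfderiv I g x - mvfderiv I h x) := by
    have h1 : MDiffAt (fun y ↦ f y - g y) x := hf.sub hg
    have h2 : MDiffAt (fun y ↦ f y - g y - h y) x := h1.sub hh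
    rw [mvfderiv_fun_mul mdifferentiableAt_const h2, mvfderiv_fun_sub h1 hh,
      mvfderiv_fun_sub hf hg, mvfderiv_const]
    simp
  rw [mvfderiv_congr (d_eventuallyEq hX hY), comb s1 s2 s3,
    α.d_apply (mdiff_of_smooth hZX) (mdiff_of_smooth hY),
    α.d_apply (mdiff_of_smooth hX) (mdiff_of_smooth hZY),
    mvfderiv_congr (near hX), mvfderiv_congr (near hY),
    mvfderiv_mlieBracket (α.smooth_apply hY) hZ hX, mvfderiv_mlieBracket (α.smooth_apply hX) hZ hY]
  -- Here `L_Z` commutes with `d`: once `dα` is expanded, what remains is `L_Z α = 0` evaluated on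
  -- `[X, Y]`, with `[Z, [X, Y]]` split by the Jacobi identity.
  have h1 := apply_mlieBracket hc hd (mdiff_of_smooth hZ) (mdiff_of_smooth hXY)
  rw [leibniz_identity_mlieBracket_apply (contMDiffAt_two hZ) (contMDiffAt_two hX)
    (contMDiffAt_two hY), map_add] at h1
  simp only [sub_apply, smul_apply, smul_eq_mul]
  linear_combination (1 / 2 : ℝ) * h1

end SmoothOneForm
end Contact

/-! ### The field `Z₁ + Z₂` of a normal metric contact pair. -/

section MetricContactPair

variable {E : Type*} [NormedAddCommGroup E] [NormedSpace ℝ E] [FiniteDimensional ℝ E]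
  {H : Type*} [TopologicalSpace H] {I : ModelWithCorners ℝ E H}
  {M : Type*} [TopologicalSpace M] [ChartedSpace H M] [IsManifold I ∞ M]
  [RiemannianBundle (fun x : M ↦ TangentSpace I x)]
  [IsContMDiffRiemannianBundle I ∞ E (fun x : M ↦ TangentSpace I x)]
  {x : M} {p q : ℕ} {S : AlmostContactPairStructure I M p q}
  {X Y : ∀ x : M, TangentSpace I x}

namespace AlmostContactPairStructure

theorem smooth_φ_apply (S : AlmostContactPairStructure I M p q) (hX : CMDiffAt ∞ (T% X) x) :
    CMDiffAt ∞ (T% (fun y ↦ S.φ y (X y))) x :=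
  ContMDiffAt.clm_bundle_apply (F₁ := E) (S.smooth_φ x) hX

theorem smooth_reeb₁ (S : AlmostContactPairStructure I M p q) (x : M) :
    CMDiffAt ∞ (T% S.Z₁) x := S.smooth_Z₁ x

theorem smooth_reeb₂ (S : AlmostContactPairStructure I M p q) (x : M) :
    CMDiffAt ∞ (T% S.Z₂) x := S.smooth_Z₂ x

/-- The sum of the Reeb vector fields. -/
noncomputable def reeb (S : AlmostContactPairStructure I M p q) : ∀ x : M, TangentSpace I x :=
  S.Z₁ + S.Z₂

theorem reeb_apply (S : AlmostContactPairStructure I M p q) (x : M) :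
    S.reeb x = S.Z₁ x + S.Z₂ x := rfl

theorem smooth_reeb (S : AlmostContactPairStructure I M p q) (x : M) :
    CMDiffAt ∞ (T% S.reeb) x :=
  (S.smooth_Z₁ x).add_section (S.smooth_Z₂ x)

theorem mlieBracket_reeb (S : AlmostContactPairStructure I M p q) (X : ∀ x : M, TangentSpace I x) :
    mlieBracket I S.reeb X x = mlieBracket I S.Z₁ X x + mlieBracket I S.Z₂ X x :=
  mlieBracket_add_left (mdiff_of_smooth (S.smooth_Z₁ x)) (mdiff_of_smooth (S.smooth_Z₂ x))

theorem φ_reeb (S : AlmostContactPairStructure I M p q) (x : M) : S.φ x (S.reeb x) = 0 := by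
  simp [reeb_apply, S.φ_Z₁, S.φ_Z₂]

theorem α₁_reeb (S : AlmostContactPairStructure I M p q) (x : M) :
    S.α₁.toFun x (S.reeb x) = 1 := by
  simp [reeb_apply, S.α₁_Z₁, S.α₁_Z₂]

theorem α₂_reeb (S : AlmostContactPairStructure I M p q) (x : M) :
    S.α₂.toFun x (S.reeb x) = 1 := by
  simp [reeb_apply, S.α₂_Z₁, S.α₂_Z₂]

theorem d_α₁_reeb (S : AlmostContactPairStructure I M p q) (x : M) (v : TangentSpace I x) :
    S.α₁.d x (S.reeb x) v = 0 := by
  simp [reeb_apply, S.d_α₁_Z₁, S.d_α₁_Z₂]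

theorem d_α₂_reeb (S : AlmostContactPairStructure I M p q) (x : M) (v : TangentSpace I x) :
    S.α₂.d x (S.reeb x) v = 0 := by
  simp [reeb_apply, S.d_α₂_Z₁, S.d_α₂_Z₂]

theorem inner_φ_swap (hm : S.IsAssociatedMetric) (u v : TangentSpace I x) :
    inner ℝ u (S.φ x v) = - inner ℝ (S.φ x u) v := by
  rw [real_inner_comm v, hm.1, hm.1, S.α₁.d_swap, S.α₂.d_swap]
  ring

theorem α₁_φ (hm : S.IsAssociatedMetric) (v : TangentSpace I x) :
    S.α₁.toFun x (S.φ x v) = 0 := by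
  rw [← hm.2.1, real_inner_comm, hm.1, S.d_α₁_Z₁, S.d_α₂_Z₁, add_zero]

theorem α₂_φ (hm : S.IsAssociatedMetric) (v : TangentSpace I x) :
    S.α₂.toFun x (S.φ x v) = 0 := by
  rw [← hm.2.2, real_inner_comm, hm.1, S.d_α₁_Z₂, S.d_α₂_Z₂, add_zero]

theorem φ_φ_φ (hm : S.IsAssociatedMetric) (v : TangentSpace I x) :
    S.φ x (S.φ x (S.φ x v)) = - S.φ x v := by
  rw [S.φ_sq, α₁_φ hm, α₂_φ hm]
  simp

/-- The Reeb vector fields commute. -/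
theorem mlieBracket_reeb_reeb (hm : S.IsAssociatedMetric) (x : M) :
    mlieBracket I S.Z₁ S.Z₂ x = 0 := by
  have h1 := S.smooth_reeb₁ x
  have h2 := S.smooth_reeb₂ x
  set W := mlieBracket I S.Z₁ S.Z₂ x with hW
  have a1 : S.α₁.toFun x W = 0 := by
    rw [hW, SmoothOneForm.apply_mlieBracket S.α₁_Z₁ S.d_α₁_Z₁ (mdiff_of_smooth h1)
      (mdiff_of_smooth h2)]
    simp [S.α₁_Z₂, mvfderiv_const]
  have a2 : S.α₂.toFun x W = 0 := by
    rw [hW, SmoothOneForm.apply_mlieBracket S.α₂_Z₁ S.d_α₂_Z₁ (mdiff_of_smooth h1)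
      (mdiff_of_smooth h2)]
    simp [S.α₂_Z₂, mvfderiv_const]
  -- Invariance of `dαᵢ` under `Z₁`, together with `i_{Z₂} dαᵢ = 0`, gives `i_W dαᵢ = 0`. Taking `v
  -- = φ W` then finishes, because `φ² W = -W` when both forms vanish on `W`.
  have hd (v : TangentSpace I x) : inner ℝ W (S.φ x v) = 0 := by
    have hv := smooth_extend (I := I) v
    have d1 := SmoothOneForm.mvfderiv_d S.α₁_Z₁ S.d_α₁_Z₁ h1 h2 hv
    have d2 := SmoothOneForm.mvfderiv_d S.α₂_Z₁ S.d_α₂_Z₁ h1 h2 hv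
    simp only [S.d_α₁_Z₂, S.d_α₂_Z₂, mvfderiv_const, zero_apply,
      FiberBundle.extend_apply_self, add_zero] at d1 d2
    rw [hm.1, ← d1, ← d2, add_zero]
  have := hd (S.φ x W)
  rw [S.φ_sq, a1, a2] at this
  simpa using this

theorem mlieBracket_reeb_Z₁ (hm : S.IsAssociatedMetric) (x : M) :
    mlieBracket I S.reeb S.Z₁ x = 0 := by
  rw [mlieBracket_reeb, mlieBracket_swap_apply (V := S.Z₂), mlieBracket_reeb_reeb hm]
  simp

theorem mlieBracket_reeb_Z₂ (hm : S.IsAssociatedMetric) (x : M) :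
    mlieBracket I S.reeb S.Z₂ x = 0 := by
  rw [mlieBracket_reeb, mlieBracket_reeb_reeb hm]
  simp

/-- On fields killed by both forms `J` and `T` coincide with `φ`, whereas `J Z₁ = Z₂` and `T Z₁ =
-Z₂`. Evaluating both Nijenhuis tensors on `(X, Z₁)` therefore separates the brackets with `Z₂` from
those with `Z₁`. -/
theorem φ_mlieBracket_of_horizontal (hm : S.IsAssociatedMetric) (hN : S.IsNormal)
    (hX : CMDiffAt ∞ (T% X) x) (h1 : ∀ y, S.α₁.toFun y (X y) = 0)
    (h2 : ∀ y, S.α₂.toFun y (X y) = 0) :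
    mlieBracket I S.reeb (fun y ↦ S.φ y (X y)) x = S.φ x (mlieBracket I S.reeb X x) := by
  have hZ₁ := mdiff_of_smooth (S.smooth_reeb₁ x)
  have hZ₂ := mdiff_of_smooth (S.smooth_reeb₂ x)
  have hφX := S.smooth_φ_apply hX
  have hJX : (fun y ↦ S.J y (X y)) = fun y ↦ S.φ y (X y) := by
    ext y; simp [J, h1, h2]
  have hTX : (fun y ↦ S.T y (X y)) = fun y ↦ S.φ y (X y) := by
    ext y; simp [T, h1, h2]
  have hJZ : (fun y ↦ S.J y (S.Z₁ y)) = S.Z₂ := by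
    ext y; simp [J, S.φ_Z₁, S.α₁_Z₁, S.α₂_Z₁]
  have hTZ : (fun y ↦ S.T y (S.Z₁ y)) = (-1 : ℝ) • S.Z₂ := by
    ext y; simp [T, S.φ_Z₁, S.α₁_Z₁, S.α₂_Z₁]
  have horiz {Y : ∀ x : M, TangentSpace I x} (hY : CMDiffAt ∞ (T% Y) x)
      (h1 : ∀ y, S.α₁.toFun y (Y y) = 0) (h2 : ∀ y, S.α₂.toFun y (Y y) = 0) :
      (S.α₁.toFun x (mlieBracket I Y S.Z₁ x) = 0 ∧ S.α₂.toFun x (mlieBracket I Y S.Z₁ x) = 0) ∧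
      S.α₁.toFun x (mlieBracket I Y S.Z₂ x) = 0 ∧ S.α₂.toFun x (mlieBracket I Y S.Z₂ x) = 0 := by
    have hY' := mdiff_of_smooth hY
    refine ⟨⟨?_, ?_⟩, ?_, ?_⟩ <;> rw [mlieBracket_swap_apply, map_neg, neg_eq_zero]
    · rw [SmoothOneForm.apply_mlieBracket S.α₁_Z₁ S.d_α₁_Z₁ hZ₁ hY']
      simp [h1, mvfderiv_const]
    · rw [SmoothOneForm.apply_mlieBracket S.α₂_Z₁ S.d_α₂_Z₁ hZ₁ hY']
      simp [h2, mvfderiv_const]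
    · rw [SmoothOneForm.apply_mlieBracket S.α₁_Z₂ S.d_α₁_Z₂ hZ₂ hY']
      simp [h1, mvfderiv_const]
    · rw [SmoothOneForm.apply_mlieBracket S.α₂_Z₂ S.d_α₂_Z₂ hZ₂ hY']
      simp [h2, mvfderiv_const]
  have hJ (v : TangentSpace I x) (hv : S.α₁.toFun x v = 0 ∧ S.α₂.toFun x v = 0) :
      S.J x v = S.φ x v := by
    simp [J, hv.1, hv.2]
  have hT (v : TangentSpace I x) (hv : S.α₁.toFun x v = 0 ∧ S.α₂.toFun x v = 0) :
      S.T x v = S.φ x v := by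
    simp [T, hv.1, hv.2]
  have bX := horiz hX h1 h2
  have bφ := horiz hφX (fun y ↦ α₁_φ hm _) (fun y ↦ α₂_φ hm _)
  have nJ := hN.1 X S.Z₁ x (mdiff_of_smooth hX) hZ₁
  have nT := hN.2 X S.Z₁ x (mdiff_of_smooth hX) hZ₁
  rw [nijenhuis, hJX, hJZ, hJ _ bφ.1, hJ _ bX.2] at nJ
  rw [nijenhuis, hTX, hTZ, mlieBracket_const_smul_right hZ₂, mlieBracket_const_smul_right hZ₂,
    map_smul, hT _ bφ.1, hT _ bX.2] at nT
  -- The difference of the two Nijenhuis equations is twice this identity.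
  have e2 : mlieBracket I (fun y ↦ S.φ y (X y)) S.Z₂ x = S.φ x (mlieBracket I X S.Z₂ x) := by
    have : (2 : ℝ) • (mlieBracket I (fun y ↦ S.φ y (X y)) S.Z₂ x
        - S.φ x (mlieBracket I X S.Z₂ x)) = 0 := by
      rw [← sub_eq_zero.2 (nJ.trans nT.symm)]
      module
    exact sub_eq_zero.1 ((smul_eq_zero.1 this).resolve_left two_ne_zero)
  -- What is left of `nJ` is `φ [φ X, Z₁] = -[X, Z₁]`; apply `φ` and use `φ² = -1` on horizontal
  -- vectors.
  have e1 : mlieBracket I (fun y ↦ S.φ y (X y)) S.Z₁ x = S.φ x (mlieBracket I X S.Z₁ x) := by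
    rw [e2] at nJ
    have h3 : S.φ x (mlieBracket I (fun y ↦ S.φ y (X y)) S.Z₁ x) = - mlieBracket I X S.Z₁ x := by
      rw [← sub_eq_zero, ← neg_eq_zero, ← nJ]
      abel
    have h4 := congrArg (S.φ x) h3
    rw [S.φ_sq, bφ.1.1, bφ.1.2] at h4
    simpa using h4
  rw [mlieBracket_reeb, mlieBracket_reeb, map_add, mlieBracket_swap_apply (V := S.Z₁),
    mlieBracket_swap_apply (V := S.Z₂), e1, e2, mlieBracket_swap_apply (V := S.Z₁) (W := X),
    mlieBracket_swap_apply (V := S.Z₂) (W := X), map_neg, map_neg]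

/-- The flow of the sum of the Reeb fields of a normal metric contact pair preserves `φ`. -/
theorem φ_mlieBracket (hm : S.IsAssociatedMetric) (hN : S.IsNormal)
    (hX : CMDiffAt ∞ (T% X) x) :
    mlieBracket I S.reeb (fun y ↦ S.φ y (X y)) x = S.φ x (mlieBracket I S.reeb X x) := by
  have hφX := S.smooth_φ_apply hX
  have hφφX := S.smooth_φ_apply hφX
  -- The horizontal case is applied to `φ² X`. On the left `φ³ = -φ`; on the right `φ² X` differs
  -- from `-X` by function multiples of `Z₁` and `Z₂`, whose brackets with `Z` are again such
  -- multiples and are killed by `φ`.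
  have h := φ_mlieBracket_of_horizontal hm hN hφφX (fun y ↦ α₁_φ hm _) (fun y ↦ α₂_φ hm _)
  have e1 : (fun y ↦ S.φ y (S.φ y (S.φ y (X y)))) = (-1 : ℝ) • fun y ↦ S.φ y (X y) := by
    ext y; simp [φ_φ_φ hm]
  have f1 := S.α₁.smooth_apply hX
  have f2 := S.α₂.smooth_apply hX
  have e2 : (fun y ↦ S.φ y (S.φ y (X y))) = ((-1 : ℝ) • X + (fun y ↦ S.α₁.toFun y (X y)) • S.Z₁)
      + (fun y ↦ S.α₂.toFun y (X y)) • S.Z₂ := by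
    ext y; simp [S.φ_sq]
  have s0 : CMDiffAt ∞ (T% ((-1 : ℝ) • X)) x :=
    (contMDiffAt_const (c := (-1 : ℝ))).smul_section hX
  have s1 : CMDiffAt ∞ (T% ((fun y ↦ S.α₁.toFun y (X y)) • S.Z₁)) x :=
    f1.smul_section (S.smooth_reeb₁ x)
  have s2 : CMDiffAt ∞ (T% ((fun y ↦ S.α₂.toFun y (X y)) • S.Z₂)) x :=
    f2.smul_section (S.smooth_reeb₂ x)
  have s01 : CMDiffAt ∞ (T% ((-1 : ℝ) • X + (fun y ↦ S.α₁.toFun y (X y)) • S.Z₁)) x :=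
    s0.add_section s1
  rw [e1, e2, mlieBracket_const_smul_right (mdiff_of_smooth hφX),
    mlieBracket_add_right (mdiff_of_smooth s01) (mdiff_of_smooth s2),
    mlieBracket_add_right (mdiff_of_smooth s0) (mdiff_of_smooth s1),
    mlieBracket_const_smul_right (mdiff_of_smooth hX),
    mlieBracket_smul_right (f1.mdifferentiableAt (by simp)) (mdiff_of_smooth (S.smooth_reeb₁ x)),
    mlieBracket_smul_right (f2.mdifferentiableAt (by simp)) (mdiff_of_smooth (S.smooth_reeb₂ x)),
    mlieBracket_reeb_Z₁ hm, mlieBracket_reeb_Z₂ hm] at h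
  simpa [S.φ_Z₁, S.φ_Z₂] using h

/-- The sum of the Reeb fields of a normal metric contact pair is a Killing field. -/
theorem inner_nabla_reeb_skew (hm : S.IsAssociatedMetric) (hN : S.IsNormal)
    (u v : TangentSpace I x) :
    inner ℝ (leviCivita I M S.reeb x u) v + inner ℝ u (leviCivita I M S.reeb x v) = 0 := by
  have hZ := S.smooth_reeb x
  -- Invariance of `g` under `Z` on the pair `X`, `Y` is rewritten as skewness of `∇ Z`. It is then
  -- checked for second arguments `φ w`, `Z₁` and `Z₂`, where `g` is given by `dα₁ + dα₂`, `α₁` and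
  -- `α₂`; these vectors span the tangent space.
  have lie {X Y : ∀ x : M, TangentSpace I x} (hX : CMDiffAt ∞ (T% X) x)
      (hY : CMDiffAt ∞ (T% Y) x)
      (h : mvfderiv I (fun y ↦ inner ℝ (X y) (Y y)) x (S.reeb x) =
        inner ℝ (mlieBracket I S.reeb X x) (Y x) + inner ℝ (X x) (mlieBracket I S.reeb Y x)) :
      inner ℝ (leviCivita I M S.reeb x (X x)) (Y x)
        + inner ℝ (X x) (leviCivita I M S.reeb x (Y x)) = 0 := by
    rw [mvfderiv_inner (mdiff_of_smooth hZ) (mdiff_of_smooth hX) (mdiff_of_smooth hY),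
      ← nabla_sub_nabla (mdiff_of_smooth hZ) (mdiff_of_smooth hX),
      ← nabla_sub_nabla (mdiff_of_smooth hZ) (mdiff_of_smooth hY), inner_sub_left,
      inner_sub_right] at h
    simp only [nabla] at h
    linarith
  have hu := smooth_extend (I := I) u
  have k0 (w : TangentSpace I x) : inner ℝ (leviCivita I M S.reeb x u) (S.φ x w)
      + inner ℝ u (leviCivita I M S.reeb x (S.φ x w)) = 0 := by
    have hw := smooth_extend (I := I) w
    have := lie hu (S.smooth_φ_apply hw) (by
      have d1 := SmoothOneForm.mvfderiv_d S.α₁_reeb S.d_α₁_reeb hZ hu hw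
      have d2 := SmoothOneForm.mvfderiv_d S.α₂_reeb S.d_α₂_reeb hZ hu hw
      have m1 := (S.α₁.smooth_d_apply hu hw).mdifferentiableAt (by simp)
      have m2 := (S.α₂.smooth_d_apply hu hw).mdifferentiableAt (by simp)
      rw [φ_mlieBracket hm hN hw]
      simp only [hm.1]
      rw [mvfderiv_fun_add m1 m2, add_apply, d1, d2]
      ring)
    simpa using this
  have k1 : inner ℝ (leviCivita I M S.reeb x u) (S.Z₁ x)
      + inner ℝ u (leviCivita I M S.reeb x (S.Z₁ x)) = 0 := by
    have := lie hu (S.smooth_reeb₁ x) (by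
      have b1 := mlieBracket_reeb_Z₁ hm x
      simp only [hm.2.1, b1, inner_zero_right, add_zero]
      exact (SmoothOneForm.apply_mlieBracket S.α₁_reeb S.d_α₁_reeb (mdiff_of_smooth hZ)
        (mdiff_of_smooth hu)).symm)
    simpa using this
  have k2 : inner ℝ (leviCivita I M S.reeb x u) (S.Z₂ x)
      + inner ℝ u (leviCivita I M S.reeb x (S.Z₂ x)) = 0 := by
    have := lie hu (S.smooth_reeb₂ x) (by
      have b1 := mlieBracket_reeb_Z₂ hm x
      simp only [hm.2.2, b1, inner_zero_right, add_zero]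
      exact (SmoothOneForm.apply_mlieBracket S.α₂_reeb S.d_α₂_reeb (mdiff_of_smooth hZ)
        (mdiff_of_smooth hu)).symm)
    simpa using this
  have hv : v = - S.φ x (S.φ x v) + S.α₁.toFun x v • S.Z₁ x + S.α₂.toFun x v • S.Z₂ x := by
    rw [S.φ_sq]; abel
  rw [hv]
  simp only [map_add, map_neg, map_smul, inner_add_right, inner_neg_right, inner_smul_right]
  linear_combination - k0 (S.φ x v) + S.α₁.toFun x v * k1 + S.α₂.toFun x v * k2

/-- In a normal metric contact pair `∇_v (Z₁ + Z₂) = -φ v`. -/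
theorem leviCivita_reeb (hm : S.IsAssociatedMetric) (hN : S.IsNormal) (v : TangentSpace I x) :
    leviCivita I M S.reeb x v = - S.φ x v := by
  refine ext_inner_right ℝ fun w ↦ ?_
  have hv := mdiff_of_smooth (smooth_extend (I := I) v)
  have hw := mdiff_of_smooth (smooth_extend (I := I) w)
  have hZ := mdiff_of_smooth (S.smooth_reeb x)
  have hη (y : M) (u : TangentSpace I y) :
      S.α₁.toFun y u + S.α₂.toFun y u = inner ℝ u (S.reeb y) := by
    rw [reeb_apply, inner_add_right, hm.2.1, hm.2.2]
  -- For the form dual to `Z`, `d` is half of `g(∇_X Z, Y) - g(X, ∇_Y Z)`; the Killing property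
  -- makes the two terms equal, and the factor `1/2` in `d` cancels the doubling.
  have key {X Y : ∀ x : M, TangentSpace I x} (hX : MDiffAt (T% X) x) (hY : MDiffAt (T% Y) x) :
      S.α₁.d x (X x) (Y x) + S.α₂.d x (X x) (Y x) =
        inner ℝ (leviCivita I M S.reeb x (X x)) (Y x) := by
    have e {X : ∀ x : M, TangentSpace I x} (hX : MDiffAt (T% X) x) :
        mvfderiv I (fun y ↦ S.α₁.toFun y (X y)) x + mvfderiv I (fun y ↦ S.α₂.toFun y (X y)) x =
          mvfderiv I (fun y ↦ inner ℝ (X y) (S.reeb y)) x := by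
      rw [← mvfderiv_fun_add (S.α₁.mdifferentiableAt_apply hX) (S.α₂.mdifferentiableAt_apply hX)]
      simp only [hη]
    have e1 := congrArg (· (Y x)) (e hX)
    have e2 := congrArg (· (X x)) (e hY)
    have e3 := hη x (mlieBracket I X Y x)
    have k := inner_nabla_reeb_skew hm hN (X x) (Y x)
    simp only [add_apply] at e1 e2
    rw [mvfderiv_inner hY hX hZ] at e1
    rw [mvfderiv_inner hX hY hZ] at e2
    rw [← nabla_sub_nabla hX hY, inner_sub_left] at e3
    rw [S.α₁.d_apply hX hY, S.α₂.d_apply hX hY]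
    simp only [nabla] at e1 e2 e3
    rw [← nabla_sub_nabla hX hY, map_sub, map_sub]
    simp only [nabla, map_sub] at e3 ⊢
    rw [real_inner_comm _ (Y x)] at e2
    linarith
  have h := key hv hw
  simp only [FiberBundle.extend_apply_self] at h
  rw [← h, ← hm.1, inner_φ_swap hm, inner_neg_left]

/-- In a normal metric contact pair `R(u, Z) Z = -φ² u` for `Z = Z₁ + Z₂`. -/
theorem curvature_reeb_reeb (hm : S.IsAssociatedMetric) (hN : S.IsNormal)
    (u : TangentSpace I x) :
    curvature x u (S.reeb x) (S.reeb x) = - S.φ x (S.φ x u) := by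
  have hu := smooth_extend (I := I) u
  have hZ := S.smooth_reeb x
  have hφ := S.smooth_φ_apply hu
  have h := curvature_eq hu hZ hZ
  rw [FiberBundle.extend_apply_self] at h
  have n (X : ∀ x : M, TangentSpace I x) : nabla X S.reeb = (-1 : ℝ) • fun y ↦ S.φ y (X y) := by
    ext y; simp [nabla, leviCivita_reeb hm hN]
  have n0 : nabla S.reeb S.reeb = 0 := by
    ext y; simp [nabla, leviCivita_reeb hm hN, φ_reeb]
  have n1 : nabla S.reeb (nabla (FiberBundle.extend E u) S.reeb) x =
      - nabla S.reeb (fun y ↦ S.φ y (FiberBundle.extend E u y)) x := by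
    have := (leviCivita I M).isCovariantDerivativeOnUniv.smul_const (-1) (mdiff_of_smooth hφ)
    rw [n, nabla, nabla]
    refine (congrArg (· (S.reeb x)) this).trans ?_
    simp
  have n2 : nabla (FiberBundle.extend E u) (nabla S.reeb S.reeb) x = 0 := by
    rw [n0, nabla, CovariantDerivative.zero]; rfl
  -- By `∇ Z = -φ` the curvature equals `∇_Z (φ U) + φ [U, Z]`. Vanishing torsion gives `∇_Z (φ U) =
  -- φ [Z, U] - φ² U`, and the brackets cancel.
  have n3 := nabla_sub_nabla (mdiff_of_smooth hZ) (mdiff_of_smooth hφ)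
  rw [φ_mlieBracket hm hN hu, n, mlieBracket_swap_apply, map_neg] at n3
  rw [h, curvatureField, n2, n1, n]
  rw [sub_eq_iff_eq_add] at n3
  rw [n3]
  simp

theorem inner_reeb_reeb (hm : S.IsAssociatedMetric) (x : M) :
    inner ℝ (S.reeb x) (S.reeb x) = (2 : ℝ) := by
  conv_lhs => rw [S.reeb_apply, inner_add_right, ← S.reeb_apply, hm.2.1, hm.2.2, α₁_reeb, α₂_reeb]
  norm_num

/-- In a normal metric contact pair `Ric(Z, Z) = dim M - 2` for `Z = Z₁ + Z₂`. -/
theorem ricci_reeb_reeb (hm : S.IsAssociatedMetric) (hN : S.IsNormal) (x : M) :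
    ricci x (S.reeb x) (S.reeb x) = (Module.finrank ℝ E : ℝ) - 2 := by
  have := finiteDimensional_tangentSpace (I := I) x
  rw [ricci_eq_sum]
  let e := stdOrthonormalBasis ℝ (TangentSpace I x)
  -- Here `-φ²` is the orthogonal projection off the unit vectors `Z₁` and `Z₂`; Parseval makes each
  -- of the two subtracted sums equal to `1`.
  have term (i) : inner ℝ (curvature x (e i) (S.reeb x) (S.reeb x)) (e i) =
      1 - inner ℝ (S.Z₁ x) (e i) ^ 2 - inner ℝ (S.Z₂ x) (e i) ^ 2 := by
    rw [curvature_reeb_reeb hm hN, S.φ_sq, ← hm.2.1, ← hm.2.2, real_inner_comm (S.Z₁ x),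
      real_inner_comm (S.Z₂ x)]
    simp only [inner_neg_left, inner_add_left, inner_smul_left, conj_trivial,
      e.inner_eq_one]
    ring
  have n1 : ∑ i, (inner ℝ (S.Z₁ x) (e i) : ℝ) ^ 2 = 1 := by
    rw [e.sum_sq_inner_left, ← real_inner_self_eq_norm_sq, hm.2.1, S.α₁_Z₁]
  have n2 : ∑ i, (inner ℝ (S.Z₂ x) (e i) : ℝ) ^ 2 = 1 := by
    rw [e.sum_sq_inner_left, ← real_inner_self_eq_norm_sq, hm.2.2, S.α₂_Z₂]
  refine (Finset.sum_congr rfl fun i _ ↦ term i).trans ?_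
  rw [Finset.sum_sub_distrib, Finset.sum_sub_distrib, n1, n2]
  simp only [Finset.sum_const, Finset.card_univ, Fintype.card_fin, nsmul_eq_mul, mul_one]
  rw [sub_sub]
  norm_num
  rfl

end AlmostContactPairStructure

/-- The Einstein constant of a quasi-conformally flat normal metric contact pair. -/
theorem scalarCurvature_of_flat {a b : ℝ} (hn : 2 ≤ Module.finrank ℝ E)
    (hab : a + b * ((Module.finrank ℝ E : ℝ) - 2) ≠ 0) (hm : S.IsAssociatedMetric)
    (hN : S.IsNormal) (hflat : IsQuasiConformallyFlat I M a b) (x : M) :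
    scalarCurvature I x =
      (Module.finrank ℝ E : ℝ) * (((Module.finrank ℝ E : ℝ) - 2) / 2) := by
  have h := S.ricci_reeb_reeb hm hN x
  rw [ricci, ricciOp_of_flat hn hab hflat, inner_smul_left, S.inner_reeb_reeb hm,
    conj_trivial] at h
  have hn2 : (2 : ℝ) ≤ (Module.finrank ℝ E : ℝ) := by exact_mod_cast hn
  field_simp at h
  linarith

end MetricContactPair
end ContactPairGeometry

/-! ### The theorem, by specialization to dimension `2p + 2q + 2`. -/

theorem theorem4p3 (p q : ℕ) (hp : 0 < p) (hq : 0 < q)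
    {M : Type*} [TopologicalSpace M]
    [ChartedSpace (EuclideanSpace ℝ (Fin (2 * p + 2 * q + 2))) M]
    [IsManifold (𝓡 (2 * p + 2 * q + 2)) ∞ M]
    [RiemannianBundle (fun x : M ↦ TangentSpace (𝓡 (2 * p + 2 * q + 2)) x)]
    [IsContMDiffRiemannianBundle (𝓡 (2 * p + 2 * q + 2)) ∞
      (EuclideanSpace ℝ (Fin (2 * p + 2 * q + 2)))
      (fun x : M ↦ TangentSpace (𝓡 (2 * p + 2 * q + 2)) x)]
    (S : ContactPairGeometry.AlmostContactPairStructure (𝓡 (2 * p + 2 * q + 2)) M p q)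
    (hdec : S.IsDecomposable) (hmetric : S.IsAssociatedMetric) (hnormal : S.IsNormal)
    (a b : ℝ) (hab : a + b * (2 * p + 2 * q) ≠ 0)
    (hflat : ContactPairGeometry.IsQuasiConformallyFlat (𝓡 (2 * p + 2 * q + 2)) M a b) :
    (ContactPairGeometry.IsEinsteinWith (𝓡 (2 * p + 2 * q + 2)) M ((p : ℝ) + q) ∧
      ∀ x : M,
        ContactPairGeometry.scalarCurvature (𝓡 (2 * p + 2 * q + 2)) x
          = 2 * ((p : ℝ) + q) * ((p : ℝ) + q + 1) ∧
        0 < ContactPairGeometry.scalarCurvature (𝓡 (2 * p + 2 * q + 2)) x) ∧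
    (a ≠ 0 →
      ContactPairGeometry.HasConstantSectionalCurvature (𝓡 (2 * p + 2 * q + 2)) M
        (((p : ℝ) + q) / (2 * p + 2 * q + 1))) := by
  have hfin : Module.finrank ℝ (EuclideanSpace ℝ (Fin (2 * p + 2 * q + 2))) =
      2 * p + 2 * q + 2 := finrank_euclideanSpace_fin
  have hcast : (Module.finrank ℝ (EuclideanSpace ℝ (Fin (2 * p + 2 * q + 2))) : ℝ) =
      2 * p + 2 * q + 2 := by rw [hfin]; push_cast; ring
  have hn : 2 ≤ Module.finrank ℝ (EuclideanSpace ℝ (Fin (2 * p + 2 * q + 2))) := by omega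
  have hab' : a + b *
      ((Module.finrank ℝ (EuclideanSpace ℝ (Fin (2 * p + 2 * q + 2))) : ℝ) - 2) ≠ 0 := by
    rw [hcast]
    convert hab using 2
    ring
  have hscal (x : M) : ContactPairGeometry.scalarCurvature (𝓡 (2 * p + 2 * q + 2)) x =
      (2 * p + 2 * q + 2) * ((p : ℝ) + q) := by
    rw [ContactPairGeometry.scalarCurvature_of_flat hn hab' hmetric hnormal hflat x, hcast]
    ring
  have hn0 : (2 * p + 2 * q + 2 : ℝ) ≠ 0 := by positivity
  have hQ (x : M) (u : TangentSpace (𝓡 (2 * p + 2 * q + 2)) x) :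
      ContactPairGeometry.ricciOp x u = ((p : ℝ) + q) • u := by
    rw [ContactPairGeometry.ricciOp_of_flat hn hab' hflat, hscal, hcast,
      mul_div_cancel_left₀ _ hn0]
  have hp' : (0 : ℝ) < p := Nat.cast_pos.2 hp
  have hq' : (0 : ℝ) < q := Nat.cast_pos.2 hq
  refine ⟨⟨fun x u v ↦ ?_, fun x ↦ ⟨?_, ?_⟩⟩, fun ha ↦ ?_⟩
  · rw [ContactPairGeometry.ricci, hQ, inner_smul_left, conj_trivial]
  · rw [hscal]
    ring
  · rw [hscal]
    positivity
  · have h := ContactPairGeometry.hasConstantSectionalCurvature_of_flat hn ha hflat hQ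
      (fun x ↦ by rw [hscal, hcast])
    rw [hcast] at h
    convert h using 2
    ring
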